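/- Let $I=(0,1)$, let $(\cdot,\cdot)$ and $\|\cdot\|$ denote the real $L_2(I)$-inner product and norm, and for $t\in[0,1]$ consider the scaled Timoshenko beam problem $$-M''=f,\qquad M-t^2M''+u''=0\qquad\text{in } I .\tag{1}$$ For a boundary condition type $a\in\{cc,cs,cf,ss\}$ let $\mathbb{H}^2_a(t)$ be the space of pairs $(u,M)\in H^2(I)\times H^2(I)$ such that - $a=cc$: $u(0)=u'(0)-t^2M'(0)=u(1)=u'(1)-t^2M'(1)=0$; - $a=cs$: $u(0)=u'(0)-t^2M'(0)=u(1)=M(1)=0$; - $a=cf$: $u(0)=u'(0)-t^2M'(0)=M(1)=M'(1)=0$; - $a=ss$: $u(0)=M(0)=u(1)=M(1)=0$. Let $\mathcal{T}$ be a partition of $I$ with nodes $0=x_0<x_1<\dots<x_n=1$ ($n\ge 1$), elements $I_j=(x_{j-1},x_j)$ and lengths $h_j=x_j-x_{j-1}$. Let $H^2(\mathcal{T})$ be the space of $z\in L_2(I)$ with $z_j:=z|_{I_j}\in H^2(I_j)$ for all $j$, and let $(\cdot,\cdot)_{\mathcal{T}}$ be the $L_2$-inner product taken element by element, with derivatives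 taken on each element. For $z\in H^2(\mathcal{T})$ put $$\gamma_h(z)=\bigl(z_j(x_{j-1}),\,z_j'(x_{j-1}),\,z_j(x_j),\,z_j'(x_j)\bigr)_{j=1}^n,$$ write $\gamma_h(u,M)=(\gamma_h(u),\gamma_h(M))$, and set $\widehat U_a(t)=\gamma_h(\mathbb{H}^2_a(t))$ and $U_a(t)=L_2(I)\times L_2(I)\times\widehat U_a(t)$. With $[v]_j$ denoting the value of $v|_{I_j}$ at $x_j$ minus its value at $x_{j-1}$, define for $\widehat q=\gamma_h(u,M)$, $u,M\in H^2(I)$, and $z,W\in H^2(\mathcal{T})$ $$\langle\widehat q,(z,W)\rangle_t=\sum_{j=1}^n\Bigl(-[uW']_j+[M'z]_j-[M(z'-t^2W')]_j+[(u'-t^2M')W]_j\Bigr),$$ and for $(u,M,\widehat q)\in U_a(t)$ define $$b_t\bigl((u,M,\widehat q),(z,W)\bigr)=(u,W'')_{\mathcal{T}}+(M,\,W+z''-t^2W'')_{\mathcal{T}}+\langle\widehat q,(z,W)\rangle_t .$$ For $d=(d_0,d_1,d_2,d_3)\in\mathbb{R}^4$ and $h>0$ set $$\begin{aligned}N_h(d)={}&\tfrac{h}{420}\bigl[156(d_0^2+d_2^2)+4h^2(d_1^2+d_3^2)+108\,d_0d_2+44h(d_0d_1-d_2d_3)-6h^2d_1d_3+26h(d_2d_1-d_0d_3)\bigr]\\&+\tfrac{2}{h^3}\bigl[6(d_0^2-2d_0d_2+d_2^2)+2h^2(d_1^2+d_1d_3+d_3^2)+6h(d_0d_1-d_2d_3+d_0d_3-d_2d_1)\bigr].\end{aligned}$$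 For $\widehat q=(\widehat q_1,\widehat q_2)\in\widehat U_a(t)$ put $\|\widehat q\|_h^2=\sum_{j=1}^n\bigl(N_{h_j}(\widehat q_{1,j})+N_{h_j}(\widehat q_{2,j})\bigr)$, and let $\|(u,M,\widehat q)\|_U^2=\|u\|^2+\|M\|^2+\|\widehat q\|_h^2$. **Theorem.** There is a constant $C>0$ such that for every $a\in\{cc,cs,cf,ss\}$, every $t\in[0,1]$, every partition $\mathcal{T}$ of $I$ as above and every $f\in L_2(I)$ the following holds. There is exactly one $(u,M,\widehat q)\in U_a(t)$ with $$b_t\bigl((u,M,\widehat q),(z,W)\bigr)=-(f,z)\qquad\text{for all } (z,W)\in H^2(\mathcal{T})\times H^2(\mathcal{T}).$$ It satisfies $\|(u,M,\widehat q)\|_U\le C\|f\|$. Moreover $(u,M)\in\mathbb{H}^2_a(t)$, $(u,M)$ solves (1) almost everywhere in $I$, and $\widehat q=\gamma_h(u,M)$. -/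

import Mathlib

open MeasureTheory Set
open scoped ContDiff

namespace Timoshenko

noncomputable section

/-! ### Weak derivatives, `H²` and point values on an interval -/

/-- Test functions on `(a, b)`: smooth with compact support inside `(a, b)`. -/
def IsTestFunction (a b : ℝ) (φ : ℝ → ℝ) : Prop :=
  ContDiff ℝ ∞ φ ∧ HasCompactSupport φ ∧ tsupport φ ⊆ Ioo a b

/-- `w` is a weak (distributional) derivative of `v` on `(a, b)`. -/
def HasWeakDeriv (a b : ℝ) (v w : ℝ → ℝ) : Prop :=
  LocallyIntegrableOn v (Ioo a b) ∧ LocallyIntegrableOn w (Ioo a b) ∧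
    ∀ φ : ℝ → ℝ, IsTestFunction a b φ →
      ∫ x in Ioo a b, v x * deriv φ x = -∫ x in Ioo a b, w x * φ x

/-- The restriction of `v` to `(a, b)` belongs to `H²(a, b)`: it and its first two weak
derivatives are square integrable. This depends on `v` only up to null sets of `(a, b)`. -/
def MemH2 (a b : ℝ) (v : ℝ → ℝ) : Prop :=
  MemLp v 2 (volume.restrict (Ioo a b)) ∧
    ∃ v₁ v₂ : ℝ → ℝ,
      MemLp v₁ 2 (volume.restrict (Ioo a b)) ∧ MemLp v₂ 2 (volume.restrict (Ioo a b)) ∧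
        HasWeakDeriv a b v v₁ ∧ HasWeakDeriv a b v₁ v₂

open Classical in
/-- The weak derivative of `v` on `(a, b)` (unique up to null sets; zero if there is none). -/
def weakDeriv (a b : ℝ) (v : ℝ → ℝ) : ℝ → ℝ :=
  if h : ∃ w, HasWeakDeriv a b v w then h.choose else 0

/-- The second weak derivative of `v` on `(a, b)`. -/
def weakDeriv₂ (a b : ℝ) (v : ℝ → ℝ) : ℝ → ℝ :=
  weakDeriv a b (weakDeriv a b v)

open Classical in
/-- The representative of `v` on `(a, b)` that is continuous on `[a, b]`
(unique on `[a, b]` for `a < b`; zero if there is none). -/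
def contRep (a b : ℝ) (v : ℝ → ℝ) : ℝ → ℝ :=
  if h : ∃ g : ℝ → ℝ, ContinuousOn g (Icc a b) ∧ g =ᵐ[volume.restrict (Ioo a b)] v
  then h.choose else 0

/-- The end point data `(v(a), v'(a), v(b), v'(b))` of `v ∈ H²(a, b)`, taken from inside `(a, b)`. -/
def endData (a b : ℝ) (v : ℝ → ℝ) : Fin 4 → ℝ :=
  ![contRep a b v a, contRep a b (weakDeriv a b v) a,
    contRep a b v b, contRep a b (weakDeriv a b v) b]

/-! ### The boundary value problem -/

/-- The space `L₂(I)` on `I = (0, 1)`. -/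
abbrev L2I : Type := Lp ℝ 2 (volume.restrict (Ioo (0 : ℝ) 1))

/-- Types of boundary conditions: clamped-clamped, clamped-supported, clamped-free,
supported-supported. -/
inductive BCType
  | cc
  | cs
  | cf
  | ss

/-- The boundary conditions, for end point data `u`, `M`, each ordered as
(value at `0`, derivative at `0`, value at `1`, derivative at `1`). -/
def BoundaryCondition (t : ℝ) (u M : Fin 4 → ℝ) : BCType → Prop
  | .cc => u 0 = 0 ∧ u 1 - t ^ 2 * M 1 = 0 ∧ u 2 = 0 ∧ u 3 - t ^ 2 * M 3 = 0
  | .cs => u 0 = 0 ∧ u 1 - t ^ 2 * M 1 = 0 ∧ u 2 = 0 ∧ M 2 = 0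
  | .cf => u 0 = 0 ∧ u 1 - t ^ 2 * M 1 = 0 ∧ M 2 = 0 ∧ M 3 = 0
  | .ss => u 0 = 0 ∧ M 0 = 0 ∧ u 2 = 0 ∧ M 2 = 0

/-- The space of pairs `(u, M) ∈ H²(I) × H²(I)` that satisfy the boundary conditions. -/
def solutionSpace (a : BCType) (t : ℝ) : Set (L2I × L2I) :=
  {p | MemH2 0 1 p.1 ∧ MemH2 0 1 p.2 ∧
    BoundaryCondition t (endData 0 1 p.1) (endData 0 1 p.2) a}

/-- The strong equations `-M'' = f` and `M - t² M'' + u'' = 0` in `I`. -/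
def SolvesBeam (t : ℝ) (f u M : L2I) : Prop :=
  (∀ᵐ x ∂(volume.restrict (Ioo (0 : ℝ) 1)), -weakDeriv₂ 0 1 M x = f x) ∧
  (∀ᵐ x ∂(volume.restrict (Ioo (0 : ℝ) 1)),
    M x - t ^ 2 * weakDeriv₂ 0 1 M x + weakDeriv₂ 0 1 u x = 0)

/-! ### Meshes, broken spaces and traces -/

/-- A partition `0 = x₀ < x₁ < … < xₙ = 1` of `I` (so that `n ≥ 1`). -/
structure Mesh (n : ℕ) where
  node : Fin (n + 1) → ℝ
  strictMono : StrictMono node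
  first : node 0 = 0
  last : node (Fin.last n) = 1

variable {n : ℕ}

/-- Left end point of the `j`-th element. -/
def Mesh.left (T : Mesh n) (j : Fin n) : ℝ := T.node j.castSucc

/-- Right end point of the `j`-th element. -/
def Mesh.right (T : Mesh n) (j : Fin n) : ℝ := T.node j.succ

/-- The broken space `H²(𝒯)`. -/
def brokenH2 (T : Mesh n) : Set L2I :=
  {z | ∀ j, MemH2 (T.left j) (T.right j) z}

/-- The trace map `γ_h`, element by element. -/
def traceMap (T : Mesh n) (z : L2I) : Fin n → Fin 4 → ℝ :=
  fun j => endData (T.left j) (T.right j) z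

/-- Pairs of families of end point data, one quadruple for each element. -/
abbrev TraceData (n : ℕ) : Type := (Fin n → Fin 4 → ℝ) × (Fin n → Fin 4 → ℝ)

/-- The trace space `Û_a(t) = γ_h(ℍ²_a(t))`. -/
def traceSpace (T : Mesh n) (a : BCType) (t : ℝ) : Set (TraceData n) :=
  (fun p : L2I × L2I => (traceMap T p.1, traceMap T p.2)) '' solutionSpace a t

/-- The pairing of trace data `q = (γ_h(u), γ_h(M))` with `(z, W) ∈ H²(𝒯) × H²(𝒯)`:
the sum over the elements of `-[u W'] + [M' z] - [M (z' - t² W')] + [(u' - t² M') W]`. -/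
def tracePairing (T : Mesh n) (t : ℝ) (q : TraceData n) (z W : L2I) : ℝ :=
  ∑ j,
    (-(q.1 j 2 * traceMap T W j 3 - q.1 j 0 * traceMap T W j 1)
      + (q.2 j 3 * traceMap T z j 2 - q.2 j 1 * traceMap T z j 0)
      - (q.2 j 2 * (traceMap T z j 3 - t ^ 2 * traceMap T W j 3)
        - q.2 j 0 * (traceMap T z j 1 - t ^ 2 * traceMap T W j 1))
      + ((q.1 j 3 - t ^ 2 * q.2 j 3) * traceMap T W j 2
        - (q.1 j 1 - t ^ 2 * q.2 j 1) * traceMap T W j 0))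

/-- The squared discrete norm of end point data `d` on an element of length `h`. -/
def localTraceNormSq (h : ℝ) (d : Fin 4 → ℝ) : ℝ :=
  h / 420 *
      (156 * (d 0 ^ 2 + d 2 ^ 2) + 4 * h ^ 2 * (d 1 ^ 2 + d 3 ^ 2)
        + 108 * d 0 * d 2 + 44 * h * (d 0 * d 1 - d 2 * d 3)
        - 6 * h ^ 2 * d 1 * d 3 + 26 * h * (d 2 * d 1 - d 0 * d 3))
    + 2 / h ^ 3 *
      (6 * (d 0 ^ 2 - 2 * d 0 * d 2 + d 2 ^ 2)
        + 2 * h ^ 2 * (d 1 ^ 2 + d 1 * d 3 + d 3 ^ 2)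
        + 6 * h * (d 0 * d 1 - d 2 * d 3 + d 0 * d 3 - d 2 * d 1))

/-- The squared norm `‖q‖_h²` of trace data. -/
def traceNormSq (T : Mesh n) (q : TraceData n) : ℝ :=
  ∑ j, (localTraceNormSq (T.right j - T.left j) (q.1 j)
    + localTraceNormSq (T.right j - T.left j) (q.2 j))

/-! ### The ultraweak formulation -/

/-- The trial space `U_a(t) = L₂(I) × L₂(I) × Û_a(t)`. -/
def trialSpace (T : Mesh n) (a : BCType) (t : ℝ) : Set (L2I × L2I × TraceData n) :=
  {s | s.2.2 ∈ traceSpace T a t}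

/-- The norm of the trial space. -/
def trialNorm (T : Mesh n) (s : L2I × L2I × TraceData n) : ℝ :=
  √(‖s.1‖ ^ 2 + ‖s.2.1‖ ^ 2 + traceNormSq T s.2.2)

/-- The bilinear form
`b_t((u, M, q), (z, W)) = (u, W'')_𝒯 + (M, W + z'' - t² W'')_𝒯 + ⟨q, (z, W)⟩_t`. -/
def bilinForm (T : Mesh n) (t : ℝ) (s : L2I × L2I × TraceData n) (z W : L2I) : ℝ :=
  (∑ j, ∫ x in Ioo (T.left j) (T.right j),
      s.1 x * weakDeriv₂ (T.left j) (T.right j) W x)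
  + (∑ j, ∫ x in Ioo (T.left j) (T.right j),
      s.2.1 x * (W x + weakDeriv₂ (T.left j) (T.right j) z x
        - t ^ 2 * weakDeriv₂ (T.left j) (T.right j) W x))
  + tracePairing T t s.2.2 z W

/-- `s = (u, M, q)` solves the ultraweak formulation: `s ∈ U_a(t)` and
`b_t(s, (z, W)) = -(f, z)` for all `(z, W) ∈ H²(𝒯) × H²(𝒯)`. -/
def SolvesVF (T : Mesh n) (a : BCType) (t : ℝ) (f : L2I) (s : L2I × L2I × TraceData n) : Prop :=
  s ∈ trialSpace T a t ∧
    ∀ z ∈ brokenH2 T, ∀ W ∈ brokenH2 T,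
      bilinForm T t s z W = -∫ x in Ioo (0 : ℝ) 1, f x * z x

end

end Timoshenko

/-! A solution of the ultraweak problem is the same thing as a strong solution of the boundary value
problem together with its own traces, so existence, uniqueness and stability reduce to an ODE with
constant coefficients.

By definition of the trial space the trace component is the trace of some `(u', M')` satisfying the
boundary conditions. Green's formula on each element (`element_identity`, `bilinForm_traceMap`)
absorbs this trace, and the equations then pair only `M - M'` and `(u - u') - t²(M - M')` with
second derivatives of test functions. Since broken test functions carry no boundary or continuity
conditions, each of these two `L₂` functions is in `H²(0, 1)` and vanishes with its slope at every
node (`Mesh.rep_of_forall_sum_eq_zero`). Hence `u` and `M` are in `H²`, solve the equations, and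
have the traces of `u'` and `M'`, including the boundary values (`SolvesVF.exists_beamRep`).
`BeamRep.solvesVF` is the converse.

The strong problem is explicit: `-M'' = f` and `(u - t²M)'' = -M` give iterated primitives of `f`
plus a cubic with four free constants. The boundary conditions fix these, and the only divisors are
`t² + 1/12` and `t² + 1/3`, which do not degenerate as `t → 0` (`abs_le_of_boundaryCondition`). This
yields uniform bounds on `u, u', M, M'` (`BeamRep.abs_le`).

The trace norm is the `L₂` norm together with the bending energy of the cubic Hermite interpolant.
On each element it is bounded by `sup` bounds weighted with the length and by the integral of the
squared second derivative (`H2Rep.localTraceNormSq_le`), so the sum does not depend on the mesh. -/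

namespace Timoshenko

/-! ### Primitives of integrable functions -/

/-- `V` is a primitive of the integrable function `D` on `[a, b]`. -/
structure IsPrimitive (a b : ℝ) (V D : ℝ → ℝ) : Prop where
  intervalIntegrable : IntervalIntegrable D volume a b
  eq_add_integral : ∀ x ∈ Icc a b, V x = V a + ∫ s in a..x, D s

theorem isPrimitive_integral {a b : ℝ} {D : ℝ → ℝ} (hD : IntervalIntegrable D volume a b) (c : ℝ) :
    IsPrimitive a b (fun x => c + ∫ s in a..x, D s) D :=
  ⟨hD, fun x _ => by simp⟩

theorem isPrimitive_of_hasDerivAt {a b : ℝ} {V D : ℝ → ℝ} (hV : ∀ x, HasDerivAt V (D x) x)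
    (hD : Continuous D) : IsPrimitive a b V D := by
  refine ⟨hD.intervalIntegrable a b, fun x _ => ?_⟩
  rw [intervalIntegral.integral_eq_sub_of_hasDerivAt (fun y _ => hV y)
    (hD.intervalIntegrable a x)]
  ring

namespace IsPrimitive

variable {a b : ℝ} {V D Z E : ℝ → ℝ}

theorem intervalIntegrable_sub (h : IsPrimitive a b V D) {c d : ℝ} (hc : c ∈ Icc a b)
    (hd : d ∈ Icc a b) : IntervalIntegrable D volume c d := by
  have hab : a ≤ b := hc.1.trans hc.2
  apply h.intervalIntegrable.mono_set
  rw [← uIcc_of_le hab] at hc hd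
  exact uIcc_subset_uIcc hc hd

theorem sub_eq_integral (h : IsPrimitive a b V D) {c d : ℝ} (hc : c ∈ Icc a b)
    (hd : d ∈ Icc a b) : V d - V c = ∫ s in c..d, D s := by
  have ha : a ∈ Icc a b := ⟨le_rfl, hc.1.trans hc.2⟩
  rw [h.eq_add_integral d hd, h.eq_add_integral c hc,
    ← intervalIntegral.integral_add_adjacent_intervals (h.intervalIntegrable_sub ha hc)
      (h.intervalIntegrable_sub hc hd)]
  ring

theorem mono (h : IsPrimitive a b V D) {c d : ℝ} (hac : a ≤ c) (hcd : c ≤ d) (hdb : d ≤ b) :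
    IsPrimitive c d V D := by
  have hc : c ∈ Icc a b := ⟨hac, hcd.trans hdb⟩
  refine ⟨h.intervalIntegrable_sub hc ⟨hac.trans hcd, hdb⟩, fun x hx => ?_⟩
  rw [← h.sub_eq_integral hc ⟨hac.trans hx.1, hx.2.trans hdb⟩]
  ring

theorem add (h : IsPrimitive a b V D) (k : IsPrimitive a b Z E) :
    IsPrimitive a b (fun x => V x + Z x) (fun x => D x + E x) := by
  refine ⟨h.intervalIntegrable.add k.intervalIntegrable, fun x hx => ?_⟩
  have ha : a ∈ Icc a b := ⟨le_rfl, hx.1.trans hx.2⟩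
  rw [intervalIntegral.integral_add (h.intervalIntegrable_sub ha hx)
    (k.intervalIntegrable_sub ha hx), h.eq_add_integral x hx, k.eq_add_integral x hx]
  ring

theorem const_mul (h : IsPrimitive a b V D) (c : ℝ) :
    IsPrimitive a b (fun x => c * V x) (fun x => c * D x) := by
  refine ⟨h.intervalIntegrable.const_mul c, fun x hx => ?_⟩
  rw [intervalIntegral.integral_const_mul, h.eq_add_integral x hx]
  ring

/-- Phrased for the integral formula, whose derivative is `D` almost everywhere by Lebesgue
differentiation; this is the form that integration by parts uses. -/
theorem absolutelyContinuous (h : IsPrimitive a b V D) (c : ℝ) :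
    AbsolutelyContinuousOnInterval (fun x => c + ∫ s in a..x, D s) a b := by
  have h1 : AbsolutelyContinuousOnInterval (fun _ : ℝ => c) a b :=
    ((LipschitzWith.const c).lipschitzOnWith (s := uIcc a b)).absolutelyContinuousOnInterval
  exact h1.fun_add
    (h.intervalIntegrable.absolutelyContinuousOnInterval_intervalIntegral left_mem_uIcc)

theorem continuousOn (h : IsPrimitive a b V D) : ContinuousOn V (Icc a b) := by
  rcases lt_or_ge b a with hab | hab
  · simp [Icc_eq_empty_of_lt hab]
  have := (h.absolutelyContinuous (V a)).continuousOn
  rw [uIcc_of_le hab] at this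
  exact this.congr h.eq_add_integral

theorem continuousOn_uIcc (h : IsPrimitive a b V D) (hab : a ≤ b) :
    ContinuousOn V (uIcc a b) := by
  rw [uIcc_of_le hab]
  exact h.continuousOn

theorem integral_mul_add (h : IsPrimitive a b V D) (k : IsPrimitive a b Z E) (hab : a ≤ b) :
    (∫ x in a..b, D x * Z x) + ∫ x in a..b, V x * E x = V b * Z b - V a * Z a := by
  have hb : b ∈ Icc a b := ⟨hab, le_rfl⟩
  have e := AbsolutelyContinuousOnInterval.integral_deriv_mul_eq_sub
    (h.absolutelyContinuous (V a)) (k.absolutelyContinuous (Z a))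
  rw [← h.eq_add_integral b hb, ← k.eq_add_integral b hb] at e
  simp only [intervalIntegral.integral_same, add_zero] at e
  rw [← e, ← intervalIntegral.integral_add
    (h.intervalIntegrable.mul_continuousOn (k.continuousOn_uIcc hab))
    (k.intervalIntegrable.continuousOn_mul (h.continuousOn_uIcc hab))]
  apply intervalIntegral.integral_congr_ae
  filter_upwards [h.intervalIntegrable.ae_hasDerivAt_integral,
    k.intervalIntegrable.ae_hasDerivAt_integral] with x hx hx' hxm
  have hxu := uIoc_subset_uIcc hxm
  have hxc : x ∈ Icc a b := by rwa [uIcc_of_le hab] at hxu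
  rw [((hx hxu a left_mem_uIcc).const_add _).deriv, ((hx' hxu a left_mem_uIcc).const_add _).deriv,
    ← h.eq_add_integral x hxc, ← k.eq_add_integral x hxc]

end IsPrimitive

/-! ### Weak derivatives -/

theorem setIntegral_Ioo_eq {a b : ℝ} (hab : a ≤ b) (f : ℝ → ℝ) :
    ∫ x in Ioo a b, f x = ∫ x in a..b, f x := by
  rw [intervalIntegral.integral_of_le hab, integral_Ioc_eq_integral_Ioo]

theorem intervalIntegrable_iff_Ioo {a b : ℝ} (hab : a ≤ b) (f : ℝ → ℝ) :
    IntervalIntegrable f volume a b ↔ IntegrableOn f (Ioo a b) :=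
  intervalIntegrable_iff_integrableOn_Ioo_of_le hab

namespace IsTestFunction

variable {a b : ℝ} {φ : ℝ → ℝ}

theorem eq_zero (hφ : IsTestFunction a b φ) {x : ℝ} (hx : x ∉ Ioo a b) : φ x = 0 :=
  image_eq_zero_of_notMem_tsupport fun h => hx (hφ.2.2 h)

theorem continuous (hφ : IsTestFunction a b φ) : Continuous φ := hφ.1.continuous

theorem deriv (hφ : IsTestFunction a b φ) : IsTestFunction a b (deriv φ) :=
  ⟨hφ.1.deriv', hφ.2.1.deriv, tsupport_deriv_subset.trans hφ.2.2⟩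

theorem isPrimitive (hφ : IsTestFunction a b φ) : IsPrimitive a b φ (_root_.deriv φ) :=
  isPrimitive_of_hasDerivAt
    (fun x => (hφ.1.differentiable (by simp) x).hasDerivAt) hφ.deriv.continuous

theorem integrableOn_mul (hφ : IsTestFunction a b φ) {v : ℝ → ℝ}
    (hv : LocallyIntegrableOn v (Ioo a b)) : IntegrableOn (fun x => v x * φ x) (Ioo a b) := by
  have h1 : IntegrableOn v (tsupport φ) := hv.integrableOn_compact_subset hφ.2.2 hφ.2.1
  have h2 : IntegrableOn (fun x => v x * φ x) (tsupport φ) :=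
    h1.mul_continuousOn hφ.continuous.continuousOn hφ.2.1
  have h3 : Integrable (fun x => v x * φ x) := by
    rw [← integrableOn_iff_integrable_of_support_subset (s := tsupport φ)]
    · exact h2
    · intro x hx
      exact subset_tsupport φ (right_ne_zero_of_mul hx)
  exact h3.integrableOn

theorem sub (hφ : IsTestFunction a b φ) {ψ : ℝ → ℝ} (hψ : IsTestFunction a b ψ) (c : ℝ) :
    IsTestFunction a b (fun x => φ x - c * ψ x) := by
  refine ⟨hφ.1.sub (contDiff_const.mul hψ.1), hφ.2.1.sub hψ.2.1.mul_left, ?_⟩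
  refine (tsupport_sub _ _).trans (union_subset hφ.2.2 ?_)
  exact (tsupport_mul_subset_right).trans hψ.2.2

/-- The primitive from `a` is zero to the left of the support because the integrand is, and to the
right of it because the total integral is zero. -/
theorem exists_primitive (hφ : IsTestFunction a b φ) (h0 : ∫ x in a..b, φ x = 0) :
    ∃ Φ, IsTestFunction a b Φ ∧ _root_.deriv Φ = φ := by
  have hd : ∀ x, HasDerivAt (fun y => ∫ s in a..y, φ s) (φ x) x := fun x =>
    intervalIntegral.integral_hasDerivAt_right (hφ.continuous.intervalIntegrable _ _)
      (hφ.continuous.stronglyMeasurableAtFilter _ _) hφ.continuous.continuousAt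
  have hderiv : _root_.deriv (fun y => ∫ s in a..y, φ s) = φ := funext fun x => (hd x).deriv
  have hsub : tsupport (fun y => ∫ s in a..y, φ s) ⊆ Ioo a b := by
    rcases (tsupport φ).eq_empty_or_nonempty with he | hne
    · have hz : φ = 0 := by rwa [tsupport_eq_empty_iff] at he
      simp [hz, tsupport]
    obtain ⟨c, hcm, hc⟩ := hφ.2.1.exists_isLeast hne
    obtain ⟨d, hdm, hd'⟩ := hφ.2.1.exists_isGreatest hne
    have hca := hφ.2.2 hcm
    have hda := hφ.2.2 hdm
    have : tsupport (fun y => ∫ s in a..y, φ s) ⊆ Icc c d := by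
      apply closure_minimal _ isClosed_Icc
      intro x hx
      by_contra hxn
      apply hx
      beta_reduce
      rcases lt_or_ge x c with hxc | hxc
      · rw [intervalIntegral.integral_congr (g := fun _ => (0 : ℝ)), intervalIntegral.integral_zero]
        intro s hs
        apply image_eq_zero_of_notMem_tsupport
        intro hs'
        have := hc hs'
        have h2 := hs.2
        rcases max_choice a x with h | h <;> rw [h] at h2 <;> linarith [hca.1]
      · have hxd : d < x := by
          by_contra! h
          exact hxn ⟨hxc, h⟩
        have e : ∫ s in x..b, φ s = 0 := by
          rw [intervalIntegral.integral_congr (g := fun _ => (0 : ℝ)),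
            intervalIntegral.integral_zero]
          intro s hs
          apply image_eq_zero_of_notMem_tsupport
          intro hs'
          have := hd' hs'
          have h2 := hs.1
          rcases min_choice x b with h | h <;> rw [h] at h2 <;> linarith [hda.2]
        have := intervalIntegral.integral_add_adjacent_intervals
          (hφ.continuous.intervalIntegrable (μ := volume) a x)
          (hφ.continuous.intervalIntegrable x b)
        linarith
    exact this.trans (Icc_subset_Ioo hca.1 hda.2)
  refine ⟨fun y => ∫ s in a..y, φ s, ⟨?_, ?_, hsub⟩, hderiv⟩
  · rw [contDiff_infty_iff_deriv, hderiv]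
    exact ⟨fun x => (hd x).differentiableAt, hφ.1⟩
  · exact HasCompactSupport.of_support_subset_isCompact isCompact_Icc
      ((subset_tsupport _).trans (hsub.trans Ioo_subset_Icc_self))

theorem exists_integral_eq_one (hab : a < b) :
    ∃ ρ, IsTestFunction a b ρ ∧ ∫ x in a..b, ρ x = 1 := by
  let f : ContDiffBump ((a + b) / 2) := ⟨(b - a) / 8, (b - a) / 4, by linarith, by linarith⟩
  have hs : tsupport (f.normed volume) ⊆ Ioo a b := by
    rw [f.tsupport_normed_eq, Real.closedBall_eq_Icc]
    apply Icc_subset_Ioo <;> simp only [f] <;> linarith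
  refine ⟨f.normed volume, ⟨f.contDiff_normed, f.hasCompactSupport_normed, hs⟩, ?_⟩
  rw [← setIntegral_Ioo_eq hab.le, setIntegral_eq_integral_of_forall_compl_eq_zero]
  · exact f.integral_normed
  · exact fun x hx => image_eq_zero_of_notMem_tsupport fun h => hx (hs h)

end IsTestFunction

theorem ae_eq_of_forall_isTestFunction {a b : ℝ} {v w : ℝ → ℝ}
    (hv : LocallyIntegrableOn v (Ioo a b)) (hw : LocallyIntegrableOn w (Ioo a b))
    (h : ∀ φ, IsTestFunction a b φ → ∫ x in Ioo a b, v x * φ x = ∫ x in Ioo a b, w x * φ x) :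
    v =ᵐ[volume.restrict (Ioo a b)] w := by
  have := isOpen_Ioo.ae_eq_zero_of_integral_contDiff_smul_eq_zero (hv.sub hw)
    (fun g hg hc hs => ?_)
  · rw [Filter.EventuallyEq, ae_restrict_iff' measurableSet_Ioo]
    filter_upwards [this] with x hx hxm
    exact sub_eq_zero.mp (hx hxm)
  · have hφ : IsTestFunction a b g := ⟨hg, hc, hs⟩
    rw [← setIntegral_eq_integral_of_forall_compl_eq_zero (s := Ioo a b)
      (fun x hx => by simp [hφ.eq_zero hx])]
    have := h g hφ
    rw [← sub_eq_zero, ← integral_sub (hφ.integrableOn_mul hv) (hφ.integrableOn_mul hw)] at this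
    rw [← this]
    congr 1
    ext x
    simp only [smul_eq_mul, Pi.sub_apply]
    ring

namespace HasWeakDeriv

variable {a b : ℝ} {v w : ℝ → ℝ}

theorem ae_unique (h : HasWeakDeriv a b v w) {w' : ℝ → ℝ} (h' : HasWeakDeriv a b v w') :
    w =ᵐ[volume.restrict (Ioo a b)] w' :=
  ae_eq_of_forall_isTestFunction h.2.1 h'.2.1 fun φ hφ => by
    have := (h.2.2 φ hφ).symm.trans (h'.2.2 φ hφ)
    linarith

theorem weakDeriv_ae_eq (h : HasWeakDeriv a b v w) :
    weakDeriv a b v =ᵐ[volume.restrict (Ioo a b)] w := by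
  have he : ∃ w, HasWeakDeriv a b v w := ⟨w, h⟩
  rw [weakDeriv, dif_pos he]
  exact he.choose_spec.ae_unique h

end HasWeakDeriv

theorem LocallyIntegrableOn.congr_ae {s : Set ℝ} {v v' : ℝ → ℝ} (h : LocallyIntegrableOn v s)
    (e : v =ᵐ[volume.restrict s] v') : LocallyIntegrableOn v' s := by
  intro x hx
  obtain ⟨u, hu, hi⟩ := h x hx
  refine ⟨u ∩ s, Filter.inter_mem hu self_mem_nhdsWithin, ?_⟩
  exact (hi.mono_set inter_subset_left).congr_fun_ae
    (ae_restrict_of_ae_restrict_of_subset inter_subset_right e)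

theorem HasWeakDeriv.congr {a b : ℝ} {v w v' w' : ℝ → ℝ} (h : HasWeakDeriv a b v w)
    (hv : v =ᵐ[volume.restrict (Ioo a b)] v') (hw : w =ᵐ[volume.restrict (Ioo a b)] w') :
    HasWeakDeriv a b v' w' := by
  refine ⟨LocallyIntegrableOn.congr_ae h.1 hv, LocallyIntegrableOn.congr_ae h.2.1 hw,
    fun φ hφ => ?_⟩
  have e1 := integral_congr_ae (hv.mul (ae_eq_refl (deriv φ)))
  have e2 := integral_congr_ae (hw.mul (ae_eq_refl φ))
  simp only [Pi.mul_apply] at e1 e2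
  rw [← e1, ← e2]
  exact h.2.2 φ hφ

theorem IsPrimitive.hasWeakDeriv {a b : ℝ} {V D : ℝ → ℝ} (h : IsPrimitive a b V D) (hab : a ≤ b) :
    HasWeakDeriv a b V D := by
  refine ⟨?_, ?_, fun φ hφ => ?_⟩
  · exact (h.continuousOn.mono Ioo_subset_Icc_self).locallyIntegrableOn measurableSet_Ioo
  · exact ((intervalIntegrable_iff_Ioo hab D).mp h.intervalIntegrable).locallyIntegrableOn
  · have := h.integral_mul_add hφ.isPrimitive hab
    rw [hφ.eq_zero (x := a) (by simp), hφ.eq_zero (x := b) (by simp)] at this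
    rw [setIntegral_Ioo_eq hab, setIntegral_Ioo_eq hab]
    linarith

/-- The du Bois-Reymond lemma: `v` minus a primitive of `w` has weak derivative zero and is
therefore constant. -/
theorem HasWeakDeriv.exists_isPrimitive {a b : ℝ} {v w : ℝ → ℝ} (h : HasWeakDeriv a b v w)
    (hab : a < b) (hw : IntegrableOn w (Ioo a b)) :
    ∃ V, IsPrimitive a b V w ∧ v =ᵐ[volume.restrict (Ioo a b)] V := by
  have hp := isPrimitive_integral ((intervalIntegrable_iff_Ioo hab.le w).mpr hw)
  obtain ⟨ρ, hρ, hρ1⟩ := IsTestFunction.exists_integral_eq_one hab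
  have h0 := (hp 0).hasWeakDeriv hab.le
  set P : ℝ → ℝ := fun x => 0 + ∫ s in a..x, w s with hP
  set c := ∫ x in Ioo a b, (v x - P x) * ρ x with hc
  have hl : LocallyIntegrableOn (fun x => v x - P x) (Ioo a b) := h.1.sub h0.1
  refine ⟨fun x => c + ∫ s in a..x, w s, hp c, ?_⟩
  have key : (fun x => v x - P x) =ᵐ[volume.restrict (Ioo a b)] fun _ => c := by
    apply ae_eq_of_forall_isTestFunction hl
      ((locallyIntegrable_const c).locallyIntegrableOn (Ioo a b))
    intro φ hφ
    -- Subtracting `m ρ` removes the mean of `φ`, so what is left is the derivative of a test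
    -- function and is annihilated by `v - P`. The constant must then be the `ρ`-average `c`.
    set m := ∫ x in a..b, φ x with hm
    have hη := hφ.sub hρ m
    have hη0 : ∫ x in a..b, φ x - m * ρ x = 0 := by
      rw [intervalIntegral.integral_sub (hφ.continuous.intervalIntegrable _ _)
        ((hρ.continuous.intervalIntegrable _ _).const_mul m),
        intervalIntegral.integral_const_mul, hρ1]
      ring
    obtain ⟨Φ, hΦ, hΦd⟩ := hη.exists_primitive hη0
    have e1 := h.2.2 Φ hΦ
    have e2 := h0.2.2 Φ hΦ
    rw [hΦd] at e1 e2
    have e3 : ∫ x in Ioo a b, (v x - P x) * (φ x - m * ρ x) = 0 := by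
      have := integral_sub (hη.integrableOn_mul h.1) (hη.integrableOn_mul h0.1)
      rw [e1, e2, sub_self] at this
      rw [← this]
      congr 1
      ext x
      ring
    have e4 : ∫ x in Ioo a b, (v x - P x) * (φ x - m * ρ x) =
        (∫ x in Ioo a b, (v x - P x) * φ x) - m * c := by
      rw [hc, ← integral_const_mul,
        ← integral_sub (hφ.integrableOn_mul hl) ((hρ.integrableOn_mul hl).const_mul m)]
      congr 1
      ext x
      ring
    rw [integral_const_mul, setIntegral_Ioo_eq hab.le φ, ← hm]
    linarith
  filter_upwards [key] with x hx
  have : v x - P x = c := hx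
  simp only [hP] at this
  linarith

/-! ### Functions in `H²` through twice iterated primitives -/

/-- `v` agrees a.e. on `(a, b)` with `V`, whose derivative is `D`, and `D` has the square
integrable derivative `g`. -/
structure H2Rep (a b : ℝ) (v V D g : ℝ → ℝ) : Prop where
  ae_eq : v =ᵐ[volume.restrict (Ioo a b)] V
  value : IsPrimitive a b V D
  slope : IsPrimitive a b D g
  memLp : MemLp g 2 (volume.restrict (Ioo a b))

theorem memLp_of_continuousOn {a b : ℝ} {V : ℝ → ℝ} (h : ContinuousOn V (Icc a b))
    (p : ENNReal) :
    MemLp V p (volume.restrict (Ioo a b)) := by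
  obtain ⟨C, hC⟩ := isCompact_Icc.exists_bound_of_continuousOn h
  refine MemLp.of_bound ((h.mono Ioo_subset_Icc_self).aestronglyMeasurable measurableSet_Ioo) C ?_
  rw [ae_restrict_iff' measurableSet_Ioo]
  exact Filter.Eventually.of_forall fun x hx => hC x (Ioo_subset_Icc_self hx)

theorem integrable_mul_of_memLp_two {μ : Measure ℝ} {v w : ℝ → ℝ} (hv : MemLp v 2 μ)
    (hw : MemLp w 2 μ) : Integrable (fun x => v x * w x) μ :=
  hv.integrable_mul hw

theorem intervalIntegrable_of_memLp_two {a b : ℝ} {g : ℝ → ℝ} (hab : a ≤ b)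
    (hg : MemLp g 2 (volume.restrict (Ioo a b))) : IntervalIntegrable g volume a b :=
  (intervalIntegrable_iff_Ioo hab g).mpr (hg.integrable (by norm_num))

theorem H2Rep.exists_of_memLp {a b : ℝ} {g : ℝ → ℝ} (hab : a ≤ b)
    (hg : MemLp g 2 (volume.restrict (Ioo a b))) (c d : ℝ) :
    ∃ V D, H2Rep a b V V D g ∧ V a = c ∧ D a = d := by
  have hD := isPrimitive_integral (intervalIntegrable_of_memLp_two hab hg) d
  have hV := isPrimitive_integral ((hD.continuousOn_uIcc hab).intervalIntegrable) c
  exact ⟨_, _, ⟨ae_eq_refl _, hV, hD, hg⟩, by simp, by simp⟩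

theorem MemH2.exists_rep {a b : ℝ} {v : ℝ → ℝ} (h : MemH2 a b v) (hab : a < b) :
    ∃ V D g, H2Rep a b v V D g := by
  obtain ⟨-, v₁, v₂, h1, h2, hv, hv1⟩ := h
  obtain ⟨D, hD, e1⟩ := hv1.exists_isPrimitive hab (h2.integrable (by norm_num))
  have hvD := hv.congr (ae_eq_refl v) e1
  obtain ⟨V, hV, e2⟩ := hvD.exists_isPrimitive hab
    ((memLp_of_continuousOn hD.continuousOn 1).integrable le_rfl)
  exact ⟨V, D, v₂, e2, hV, hD, h2⟩

namespace H2Rep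

variable {a b : ℝ} {v V D g z Z E k : ℝ → ℝ}

theorem memLp_self (h : H2Rep a b v V D g) : MemLp v 2 (volume.restrict (Ioo a b)) :=
  (memLp_of_continuousOn h.value.continuousOn 2).ae_eq h.ae_eq.symm

theorem hasWeakDeriv_value (h : H2Rep a b v V D g) (hab : a ≤ b) : HasWeakDeriv a b v D :=
  (h.value.hasWeakDeriv hab).congr h.ae_eq.symm (ae_eq_refl D)

theorem memH2 (h : H2Rep a b v V D g) (hab : a ≤ b) : MemH2 a b v :=
  ⟨h.memLp_self, D, g, memLp_of_continuousOn h.slope.continuousOn 2, h.memLp,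
    h.hasWeakDeriv_value hab, h.slope.hasWeakDeriv hab⟩

theorem weakDeriv_ae_eq (h : H2Rep a b v V D g) (hab : a ≤ b) :
    weakDeriv a b v =ᵐ[volume.restrict (Ioo a b)] D :=
  (h.hasWeakDeriv_value hab).weakDeriv_ae_eq

theorem weakDeriv₂_ae_eq (h : H2Rep a b v V D g) (hab : a ≤ b) :
    weakDeriv₂ a b v =ᵐ[volume.restrict (Ioo a b)] g :=
  ((h.slope.hasWeakDeriv hab).congr (h.weakDeriv_ae_eq hab).symm (ae_eq_refl g)).weakDeriv_ae_eq

end H2Rep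

/-- Continuous functions that agree almost everywhere on a nondegenerate interval agree on its
closure, so the choice in `contRep` is harmless. -/
theorem contRep_eqOn {a b : ℝ} {v V : ℝ → ℝ} (hab : a < b) (hV : ContinuousOn V (Icc a b))
    (e : v =ᵐ[volume.restrict (Ioo a b)] V) : EqOn (contRep a b v) V (Icc a b) := by
  have he : ∃ g : ℝ → ℝ, ContinuousOn g (Icc a b) ∧ g =ᵐ[volume.restrict (Ioo a b)] v :=
    ⟨V, hV, e.symm⟩
  rw [contRep, dif_pos he]
  refine Measure.eqOn_Icc_of_ae_eq volume hab.ne ?_ he.choose_spec.1 hV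
  rw [← restrict_Ioo_eq_restrict_Icc]
  exact he.choose_spec.2.trans e

namespace H2Rep

variable {a b : ℝ} {v V D g z Z E k : ℝ → ℝ}

theorem endData_eq (h : H2Rep a b v V D g) (hab : a < b) :
    endData a b v = ![V a, D a, V b, D b] := by
  have ha : a ∈ Icc a b := ⟨le_rfl, hab.le⟩
  have hb : b ∈ Icc a b := ⟨hab.le, le_rfl⟩
  have e1 := contRep_eqOn hab h.value.continuousOn h.ae_eq
  have e2 := contRep_eqOn hab h.slope.continuousOn (h.weakDeriv_ae_eq hab.le)
  rw [endData, e1 ha, e1 hb, e2 ha, e2 hb]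

theorem congr (h : H2Rep a b v V D g) (e : z =ᵐ[volume.restrict (Ioo a b)] v) :
    H2Rep a b z V D g :=
  ⟨e.trans h.ae_eq, h.value, h.slope, h.memLp⟩

theorem mono (h : H2Rep a b v V D g) {c d : ℝ} (hac : a ≤ c) (hcd : c ≤ d) (hdb : d ≤ b) :
    H2Rep c d v V D g :=
  ⟨ae_restrict_of_ae_restrict_of_subset (Ioo_subset_Ioo hac hdb) h.ae_eq,
    h.value.mono hac hcd hdb, h.slope.mono hac hcd hdb,
    h.memLp.mono_measure (Measure.restrict_mono (Ioo_subset_Ioo hac hdb) le_rfl)⟩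

theorem add (h : H2Rep a b v V D g) (h' : H2Rep a b z Z E k) :
    H2Rep a b (fun x => v x + z x) (fun x => V x + Z x) (fun x => D x + E x)
      (fun x => g x + k x) :=
  ⟨h.ae_eq.add h'.ae_eq, h.value.add h'.value, h.slope.add h'.slope, h.memLp.add h'.memLp⟩

theorem const_mul (h : H2Rep a b v V D g) (c : ℝ) :
    H2Rep a b (fun x => c * v x) (fun x => c * V x) (fun x => c * D x) (fun x => c * g x) :=
  ⟨h.ae_eq.fun_comp (c * ·), h.value.const_mul c, h.slope.const_mul c, h.memLp.const_mul c⟩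

theorem green (h : H2Rep a b v V D g) (h' : H2Rep a b z Z E k) (hab : a ≤ b) :
    (∫ x in Ioo a b, g x * z x) - ∫ x in Ioo a b, v x * k x =
      D b * Z b - D a * Z a - (V b * E b - V a * E a) := by
  have e1 : ∫ x in Ioo a b, g x * z x = ∫ x in a..b, g x * Z x := by
    rw [← setIntegral_Ioo_eq hab]
    exact integral_congr_ae ((ae_eq_refl g).mul h'.ae_eq)
  have e2 : ∫ x in Ioo a b, v x * k x = ∫ x in a..b, V x * k x := by
    rw [← setIntegral_Ioo_eq hab]
    exact integral_congr_ae (h.ae_eq.mul (ae_eq_refl k))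
  have i1 := h.slope.integral_mul_add h'.value hab
  have i2 := h.value.integral_mul_add h'.slope hab
  rw [e1, e2]
  linarith

theorem affine (a b c d : ℝ) : H2Rep a b (fun x => c + d * (x - a)) (fun x => c + d * (x - a))
    (fun _ => d) (fun _ => 0) := by
  refine ⟨ae_eq_refl _, isPrimitive_of_hasDerivAt (fun x => ?_) continuous_const,
    isPrimitive_of_hasDerivAt (fun x => hasDerivAt_const x d) continuous_const, MemLp.zero⟩
  simpa using (((hasDerivAt_id x).sub_const a).const_mul d).const_add c

/-- Very weak solutions of `p'' = -g` with homogeneous Dirichlet and Neumann conditions at both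
end points are strong solutions. -/
theorem of_forall_integral_eq_zero {p : ℝ → ℝ} (hab : a ≤ b)
    (hp : MemLp p 2 (volume.restrict (Ioo a b))) (hg : MemLp g 2 (volume.restrict (Ioo a b)))
    (h : ∀ Z E k, H2Rep a b Z Z E k →
      (∫ x in Ioo a b, p x * k x) + ∫ x in Ioo a b, g x * Z x = 0) :
    ∃ P Q, H2Rep a b p P Q (fun x => -g x) ∧ P a = 0 ∧ Q a = 0 ∧ P b = 0 ∧ Q b = 0 := by
  obtain ⟨P, Q, hP, hPa, hQa⟩ := exists_of_memLp hab hg.neg 0 0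
  -- `P` has vanishing data at `a` only. Affine test functions have zero second derivative, so they
  -- see only the load: the constant gives `Q b = 0` and `x - a` gives `P b = 0`.
  have e1 := h _ _ _ (affine a b 1 0)
  have g1 := hP.green (affine a b 1 0) hab
  have e2 := h _ _ _ (affine a b 0 1)
  have g2 := hP.green (affine a b 0 1) hab
  simp only [mul_zero, integral_zero, zero_mul, add_zero, zero_add, mul_one, one_mul, Pi.neg_apply,
    neg_mul, integral_neg, hPa, hQa, sub_zero] at e1 g1 e2 g2
  have hQb : Q b = 0 := by linarith
  rw [hQb] at g2
  have hPb : P b = 0 := by linarith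
  have hd : MemLp (fun x => p x - P x) 2 (volume.restrict (Ioo a b)) := hp.sub hP.memLp_self
  -- A test function with second derivative `p - P` turns the identity into `‖p - P‖² = 0`.
  obtain ⟨Z, E, hZ, -, -⟩ := exists_of_memLp hab hd 0 0
  have e3 := h _ _ _ hZ
  have g3 := hP.green hZ hab
  simp only [hPa, hQa, hPb, hQb, Pi.neg_apply, neg_mul, integral_neg] at g3
  have e4 : ∫ x in Ioo a b, (p x - P x) * (p x - P x) = 0 := by
    have := integral_sub (integrable_mul_of_memLp_two hp hd)
      (integrable_mul_of_memLp_two hP.memLp_self hd)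
    simp only [← sub_mul] at this
    linarith
  rw [integral_eq_zero_iff_of_nonneg (fun x => mul_self_nonneg _)
    (integrable_mul_of_memLp_two hd hd)] at e4
  refine ⟨P, Q, hP.congr ?_, hPa, hQa, hPb, hQb⟩
  filter_upwards [e4] with x hx
  exact sub_eq_zero.mp (mul_self_eq_zero.mp hx)

end H2Rep

/-! ### Meshes -/

theorem sum_integral_fin {F : ℝ → ℝ} : ∀ (n : ℕ) (x : Fin (n + 1) → ℝ),
    (∀ i j, IntervalIntegrable F volume (x i) (x j)) →
    ∑ j : Fin n, ∫ s in x j.castSucc..x j.succ, F s = ∫ s in x 0..x (Fin.last n), F s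
  | 0, x, _ => by simp
  | n + 1, x, h => by
    rw [Fin.sum_univ_castSucc]
    have := sum_integral_fin n (fun i => x i.castSucc) fun i j => h _ _
    simp only [← Fin.succ_castSucc] at this ⊢
    rw [this, Fin.castSucc_zero, Fin.succ_last]
    exact intervalIntegral.integral_add_adjacent_intervals (h _ _) (h _ _)

namespace Mesh

variable {n : ℕ} (T : Mesh n)

theorem left_lt_right (j : Fin n) : T.left j < T.right j :=
  T.strictMono (Fin.castSucc_lt_succ)

theorem node_mem (i : Fin (n + 1)) : T.node i ∈ Icc (0 : ℝ) 1 :=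
  ⟨T.first ▸ T.strictMono.monotone (Fin.zero_le i), T.last ▸ T.strictMono.monotone (Fin.le_last i)⟩

theorem left_nonneg (j : Fin n) : 0 ≤ T.left j := (T.node_mem _).1

theorem right_le_one (j : Fin n) : T.right j ≤ 1 := (T.node_mem _).2

theorem Ioo_subset (j : Fin n) : Ioo (T.left j) (T.right j) ⊆ Ioo 0 1 :=
  Ioo_subset_Ioo (T.left_nonneg j) (T.right_le_one j)

theorem right_le_left {i j : Fin n} (h : i < j) : T.right i ≤ T.left j :=
  T.strictMono.monotone (Fin.succ_le_castSucc_iff.mpr h)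

theorem disjoint_Ioo {i j : Fin n} (h : i ≠ j) :
    Disjoint (Ioo (T.left i) (T.right i)) (Ioo (T.left j) (T.right j)) := by
  rw [Set.disjoint_left]
  rintro x ⟨h1, h2⟩ ⟨h3, h4⟩
  rcases lt_or_gt_of_ne h with h | h
  · linarith [T.right_le_left h]
  · linarith [T.right_le_left h]

theorem sum_integral {F : ℝ → ℝ} (hF : IntegrableOn F (Ioo 0 1)) :
    ∑ j, ∫ x in Ioo (T.left j) (T.right j), F x = ∫ x in Ioo (0 : ℝ) 1, F x := by
  have hi := (intervalIntegrable_iff_Ioo zero_le_one F).mpr hF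
  have := sum_integral_fin n T.node (F := F) fun i j => hi.mono_set <| by
    apply uIcc_subset_uIcc <;> rw [uIcc_of_le zero_le_one] <;> exact T.node_mem _
  rw [T.first, T.last] at this
  rw [setIntegral_Ioo_eq zero_le_one, ← this]
  exact Finset.sum_congr rfl fun j _ => setIntegral_Ioo_eq (T.left_lt_right j).le F

theorem ae_restrict {p : ℝ → Prop} (h : ∀ᵐ x ∂volume.restrict (Ioo (0 : ℝ) 1), p x) (j : Fin n) :
    ∀ᵐ x ∂volume.restrict (Ioo (T.left j) (T.right j)), p x :=
  ae_restrict_of_ae_restrict_of_subset (T.Ioo_subset j) h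

theorem memLp_restrict {p : ℝ → ℝ} (h : MemLp p 2 (volume.restrict (Ioo (0 : ℝ) 1))) (j : Fin n) :
    MemLp p 2 (volume.restrict (Ioo (T.left j) (T.right j))) :=
  h.mono_measure (Measure.restrict_mono (T.Ioo_subset j) le_rfl)

end Mesh

theorem H2Rep.restrict {n : ℕ} (T : Mesh n) {v V D g : ℝ → ℝ} (h : H2Rep 0 1 v V D g) (j : Fin n) :
    H2Rep (T.left j) (T.right j) v V D g :=
  h.mono (T.left_nonneg j) (T.left_lt_right j).le (T.right_le_one j)

theorem H2Rep.traceMap_eq {n : ℕ} (T : Mesh n) {v : L2I} {V D g : ℝ → ℝ}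
    (h : H2Rep 0 1 v V D g) :
    traceMap T v = fun j => ![V (T.left j), D (T.left j), V (T.right j), D (T.right j)] :=
  funext fun j => (h.restrict T j).endData_eq (T.left_lt_right j)

theorem H2Rep.zero (a b : ℝ) : H2Rep a b (fun _ => 0) (fun _ => 0) (fun _ => 0) (fun _ => 0) := by
  simpa using H2Rep.affine a b 0 0

/-! ### Very weak solutions on a mesh -/

/-- Globally smooth test functions give regularity across the nodes; test functions supported in one
element give the vanishing data at its end points. -/
theorem Mesh.rep_of_forall_sum_eq_zero {n : ℕ} (T : Mesh n) {p g : ℝ → ℝ}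
    (hp : MemLp p 2 (volume.restrict (Ioo (0 : ℝ) 1)))
    (hg : MemLp g 2 (volume.restrict (Ioo (0 : ℝ) 1)))
    (h : ∀ (z : L2I) (Z E k : Fin n → ℝ → ℝ),
      (∀ j, H2Rep (T.left j) (T.right j) z (Z j) (E j) (k j)) →
      ∑ j, ((∫ x in Ioo (T.left j) (T.right j), p x * k j x)
        + ∫ x in Ioo (T.left j) (T.right j), g x * z x) = 0) :
    ∃ P Q, H2Rep 0 1 p P Q (fun x => -g x) ∧ (P 0 = 0 ∧ Q 0 = 0 ∧ P 1 = 0 ∧ Q 1 = 0) ∧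
      ∀ j, P (T.left j) = 0 ∧ Q (T.left j) = 0 ∧ P (T.right j) = 0 ∧ Q (T.right j) = 0 := by
  obtain ⟨P, Q, hP, hends⟩ := H2Rep.of_forall_integral_eq_zero zero_le_one hp hg
    (fun Z E k hZ => by
      have hz := hZ.memLp_self
      have hrep := hZ.congr hz.coeFn_toLp
      have := h (hz.toLp Z) (fun _ => Z) (fun _ => E) (fun _ => k) fun j => hrep.restrict T j
      rw [Finset.sum_add_distrib, T.sum_integral (integrable_mul_of_memLp_two hp hZ.memLp),
        T.sum_integral (integrable_mul_of_memLp_two hg (Lp.memLp _))] at this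
      refine Eq.trans ?_ this
      congr 1
      apply integral_congr_ae
      filter_upwards [hz.coeFn_toLp] with x hx
      rw [hx])
  refine ⟨P, Q, hP, hends, fun j => ?_⟩
  obtain ⟨P', Q', hP', h1, h2, h3, h4⟩ := H2Rep.of_forall_integral_eq_zero (T.left_lt_right j).le
    (T.memLp_restrict hp j) (T.memLp_restrict hg j) (fun Z E k hZ => by
      -- Extension by zero may jump at the nodes, which the broken space allows.
      have hz : MemLp ((Ioo (T.left j) (T.right j)).indicator Z) 2
          (volume.restrict (Ioo (0 : ℝ) 1)) := by
        rw [memLp_indicator_iff_restrict measurableSet_Ioo,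
          Measure.restrict_restrict measurableSet_Ioo, inter_eq_left.mpr (T.Ioo_subset j)]
        exact hZ.memLp_self
      have hin : (hz.toLp _ : ℝ → ℝ) =ᵐ[volume.restrict (Ioo (T.left j) (T.right j))] Z := by
        filter_upwards [T.ae_restrict hz.coeFn_toLp j, ae_restrict_mem measurableSet_Ioo]
          with x hx hm
        rw [hx, indicator_of_mem hm]
      have hout : ∀ i, i ≠ j →
          (hz.toLp _ : ℝ → ℝ) =ᵐ[volume.restrict (Ioo (T.left i) (T.right i))] fun _ => 0 := by
        intro i hi
        filter_upwards [T.ae_restrict hz.coeFn_toLp i, ae_restrict_mem measurableSet_Ioo]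
          with x hx hm
        rw [hx, indicator_of_notMem (Set.disjoint_left.mp (T.disjoint_Ioo hi) hm)]
      have := h (hz.toLp _) (fun i => if i = j then Z else fun _ => 0)
        (fun i => if i = j then E else fun _ => 0) (fun i => if i = j then k else fun _ => 0)
        (fun i => by
          by_cases hi : i = j
          · subst hi
            simpa using hZ.congr hin
          · simpa [hi] using (H2Rep.zero _ _).congr (hout i hi))
      rw [Finset.sum_eq_single j] at this
      · refine Eq.trans ?_ this
        simp only [if_true]
        congr 1
        apply integral_congr_ae
        filter_upwards [hin] with x hx
        rw [hx]
      · intro i _ hi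
        have e : ∫ x in Ioo (T.left i) (T.right i), g x * (hz.toLp _ : ℝ → ℝ) x = 0 := by
          refine (integral_congr_ae (g := fun _ => 0) ?_).trans (integral_zero _ _)
          filter_upwards [hout i hi] with x hx
          rw [hx, mul_zero]
        rw [e]
        simp [hi]
      · simp)
  -- The local and the global representative describe the same `p` on the element, so their end data
  -- coincide.
  have e := (hP.restrict T j).endData_eq (T.left_lt_right j)
  rw [hP'.endData_eq (T.left_lt_right j), h1, h2, h3, h4] at e
  have e0 := congrFun e 0
  have e1 := congrFun e 1
  have e2 := congrFun e 2
  have e3 := congrFun e 3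
  simp at e0 e1 e2 e3
  exact ⟨e0.symm, e1.symm, e2.symm, e3.symm⟩

/-! ### The bilinear form for traces of `H²` functions -/

/-- Green's formula for the pairs `(u', W)`, `(M', z)` and `(M', W)` replaces all boundary terms by
integrals. The functions `u` and `M` are only in `L₂`, so they are never differentiated. -/
theorem element_identity {a b t : ℝ} (hab : a ≤ b) {u M : ℝ → ℝ}
    {u' U U₁ U₂ M' N N₁ N₂ z Z E k W Y S m : ℝ → ℝ}
    (hu : MemLp u 2 (volume.restrict (Ioo a b))) (hM : MemLp M 2 (volume.restrict (Ioo a b)))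
    (hU : H2Rep a b u' U U₁ U₂) (hN : H2Rep a b M' N N₁ N₂)
    (hz : H2Rep a b z Z E k) (hW : H2Rep a b W Y S m) :
    (∫ x in Ioo a b, u x * m x) + (∫ x in Ioo a b, M x * (W x + k x - t ^ 2 * m x))
      + (-(U b * S b - U a * S a) + (N₁ b * Z b - N₁ a * Z a)
        - (N b * (E b - t ^ 2 * S b) - N a * (E a - t ^ 2 * S a))
        + ((U₁ b - t ^ 2 * N₁ b) * Y b - (U₁ a - t ^ 2 * N₁ a) * Y a)) =
    (∫ x in Ioo a b, ((u x - u' x) - t ^ 2 * (M x - M' x)) * m x)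
      + (∫ x in Ioo a b, (M x + U₂ x - t ^ 2 * N₂ x) * W x)
      + ((∫ x in Ioo a b, (M x - M' x) * k x) + ∫ x in Ioo a b, N₂ x * z x) := by
  have gU := hU.green hW hab
  have gz := hN.green hz hab
  have gW := hN.green hW hab
  have I {v w : ℝ → ℝ} (hv : MemLp v 2 (volume.restrict (Ioo a b)))
    (hw : MemLp w 2 (volume.restrict (Ioo a b))) := integrable_mul_of_memLp_two hv hw
  have J {v w : ℝ → ℝ} (hv : Integrable v (volume.restrict (Ioo a b)))
    (hw : Integrable w (volume.restrict (Ioo a b))) :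
    Integrable (fun x => v x - w x) (volume.restrict (Ioo a b)) := hv.sub hw
  have e1 : ∫ x in Ioo a b, M x * (W x + k x - t ^ 2 * m x) =
      (∫ x in Ioo a b, M x * W x) + (∫ x in Ioo a b, M x * k x)
        - t ^ 2 * ∫ x in Ioo a b, M x * m x := by
    rw [← integral_add (I hM hW.memLp_self) (I hM hz.memLp), ← integral_const_mul,
      ← integral_sub ((I hM hW.memLp_self).fun_add (I hM hz.memLp)) ((I hM hW.memLp).const_mul _)]
    congr 1
    ext x
    ring
  have e2 : ∫ x in Ioo a b, ((u x - u' x) - t ^ 2 * (M x - M' x)) * m x =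
      (∫ x in Ioo a b, u x * m x) - (∫ x in Ioo a b, u' x * m x)
        - t ^ 2 * ((∫ x in Ioo a b, M x * m x) - ∫ x in Ioo a b, M' x * m x) := by
    rw [← integral_sub (I hu hW.memLp) (I hU.memLp_self hW.memLp),
      ← integral_sub (I hM hW.memLp) (I hN.memLp_self hW.memLp), ← integral_const_mul,
      ← integral_sub (J (I hu hW.memLp) (I hU.memLp_self hW.memLp))
        ((J (I hM hW.memLp) (I hN.memLp_self hW.memLp)).const_mul _)]
    congr 1
    ext x
    ring
  have e3 : ∫ x in Ioo a b, (M x + U₂ x - t ^ 2 * N₂ x) * W x =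
      (∫ x in Ioo a b, M x * W x) + (∫ x in Ioo a b, U₂ x * W x)
        - t ^ 2 * ∫ x in Ioo a b, N₂ x * W x := by
    rw [← integral_add (I hM hW.memLp_self) (I hU.memLp hW.memLp_self), ← integral_const_mul,
      ← integral_sub ((I hM hW.memLp_self).fun_add (I hU.memLp hW.memLp_self))
        ((I hN.memLp hW.memLp_self).const_mul _)]
    congr 1
    ext x
    ring
  have e4 : ∫ x in Ioo a b, (M x - M' x) * k x =
      (∫ x in Ioo a b, M x * k x) - ∫ x in Ioo a b, M' x * k x := by
    rw [← integral_sub (I hM hz.memLp) (I hN.memLp_self hz.memLp)]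
    congr 1
    ext x
    ring
  rw [e1, e2, e3, e4]
  linear_combination (-1) * gU - gz + t ^ 2 * gW

theorem bilinForm_traceMap {n : ℕ} (T : Mesh n) (t : ℝ) (u M u' M' z W : L2I)
    {U U₁ U₂ N N₁ N₂ : ℝ → ℝ} {Z E k Y S m : Fin n → ℝ → ℝ}
    (hU : H2Rep 0 1 u' U U₁ U₂) (hN : H2Rep 0 1 M' N N₁ N₂)
    (hz : ∀ j, H2Rep (T.left j) (T.right j) z (Z j) (E j) (k j))
    (hW : ∀ j, H2Rep (T.left j) (T.right j) W (Y j) (S j) (m j)) :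
    bilinForm T t (u, M, (traceMap T u', traceMap T M')) z W =
      (∑ j, ((∫ x in Ioo (T.left j) (T.right j), ((u x - u' x) - t ^ 2 * (M x - M' x)) * m j x)
        + ∫ x in Ioo (T.left j) (T.right j), (M x + U₂ x - t ^ 2 * N₂ x) * W x))
      + ∑ j, ((∫ x in Ioo (T.left j) (T.right j), (M x - M' x) * k j x)
        + ∫ x in Ioo (T.left j) (T.right j), N₂ x * z x) := by
  rw [bilinForm, tracePairing, ← Finset.sum_add_distrib, ← Finset.sum_add_distrib,
    ← Finset.sum_add_distrib]
  refine Finset.sum_congr rfl fun j _ => ?_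
  have hlr := T.left_lt_right j
  rw [← element_identity hlr.le (T.memLp_restrict (Lp.memLp u) j)
    (T.memLp_restrict (Lp.memLp M) j) (hU.restrict T j) (hN.restrict T j) (hz j) (hW j)]
  have ez : traceMap T z j = _ := (hz j).endData_eq hlr
  have eW : traceMap T W j = _ := (hW j).endData_eq hlr
  have i1 : ∫ x in Ioo (T.left j) (T.right j), u x * weakDeriv₂ (T.left j) (T.right j) W x =
      ∫ x in Ioo (T.left j) (T.right j), u x * m j x := by
    apply integral_congr_ae
    filter_upwards [(hW j).weakDeriv₂_ae_eq hlr.le] with x hx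
    rw [hx]
  have i2 : ∫ x in Ioo (T.left j) (T.right j),
      M x * (W x + weakDeriv₂ (T.left j) (T.right j) z x
        - t ^ 2 * weakDeriv₂ (T.left j) (T.right j) W x) =
      ∫ x in Ioo (T.left j) (T.right j), M x * (W x + k j x - t ^ 2 * m j x) := by
    apply integral_congr_ae
    filter_upwards [(hW j).weakDeriv₂_ae_eq hlr.le, (hz j).weakDeriv₂_ae_eq hlr.le] with x hx hx'
    rw [hx, hx']
  simp only [i1, i2, ez, eW, hU.traceMap_eq T, hN.traceMap_eq T]
  simp

/-! ### Regularity of solutions of the ultraweak formulation -/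

theorem IsPrimitive.congr_ae {a b : ℝ} {V D D' : ℝ → ℝ} (h : IsPrimitive a b V D) (hab : a ≤ b)
    (e : D =ᵐ[volume.restrict (Ioo a b)] D') : IsPrimitive a b V D' := by
  refine ⟨?_, fun x hx => ?_⟩
  · rw [intervalIntegrable_iff_Ioo hab]
    exact ((intervalIntegrable_iff_Ioo hab D).mp h.intervalIntegrable).congr e
  · rw [h.eq_add_integral x hx, ← setIntegral_Ioo_eq hx.1, ← setIntegral_Ioo_eq hx.1,
      integral_congr_ae (ae_restrict_of_ae_restrict_of_subset (Ioo_subset_Ioo le_rfl hx.2) e)]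

theorem H2Rep.congr_second {a b : ℝ} {v V D g g' : ℝ → ℝ} (h : H2Rep a b v V D g) (hab : a ≤ b)
    (e : g =ᵐ[volume.restrict (Ioo a b)] g') : H2Rep a b v V D g' :=
  ⟨h.ae_eq, h.value, h.slope.congr_ae hab e, h.memLp.ae_eq e⟩

/-- `(u, M)` solves the beam equations `M'' = -f`, `u'' = -t² f - M` on `(0, 1)`, and
`U, U₁, N, N₁` are the continuous representatives of `u, u', M, M'`. -/
structure BeamRep (t : ℝ) (f u M U U₁ N N₁ : ℝ → ℝ) : Prop where
  deflection : H2Rep 0 1 u U U₁ (fun x => -(t ^ 2 * f x) - M x)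
  moment : H2Rep 0 1 M N N₁ (fun x => -f x)

theorem mem_brokenH2_of_rep {n : ℕ} {T : Mesh n} {z : L2I} {Z E k : Fin n → ℝ → ℝ}
    (h : ∀ j, H2Rep (T.left j) (T.right j) z (Z j) (E j) (k j)) : z ∈ brokenH2 T :=
  fun j => (h j).memH2 (T.left_lt_right j).le

theorem exists_rep_of_mem_brokenH2 {n : ℕ} {T : Mesh n} {z : L2I} (h : z ∈ brokenH2 T) :
    ∃ Z E k : Fin n → ℝ → ℝ, ∀ j, H2Rep (T.left j) (T.right j) z (Z j) (E j) (k j) := by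
  choose Z E k hZ using fun j => (h j).exists_rep (T.left_lt_right j)
  exact ⟨Z, E, k, hZ⟩

theorem H2Rep.zero_L2I (a b : ℝ) (ha : 0 ≤ a) (hb : b ≤ 1) :
    H2Rep a b (0 : L2I) (fun _ => 0) (fun _ => 0) (fun _ => 0) :=
  (H2Rep.zero a b).congr (ae_restrict_of_ae_restrict_of_subset (Ioo_subset_Ioo ha hb)
    (Lp.coeFn_zero _ _ _))

/-- The lift `(u', M')` of the trace is unrelated to `(u, M)` a priori. Testing shows that they
differ by functions with vanishing end data on every element. -/
theorem SolvesVF.exists_beamRep {n : ℕ} {T : Mesh n} {a : BCType} {t : ℝ} {f u M : L2I}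
    {q : TraceData n} (h : SolvesVF T a t f (u, M, q)) :
    ∃ U U₁ N N₁, BeamRep t f u M U U₁ N N₁ ∧
      BoundaryCondition t ![U 0, U₁ 0, U 1, U₁ 1] ![N 0, N₁ 0, N 1, N₁ 1] a ∧
      q = (traceMap T u, traceMap T M) := by
  obtain ⟨⟨⟨u', M'⟩, ⟨hu', hM', hbc⟩, hq⟩, hb⟩ := h
  simp only at hu' hM' hbc hq
  subst hq
  obtain ⟨U', U₁', g, hU⟩ := hu'.exists_rep zero_lt_one
  obtain ⟨N', N₁', k, hN⟩ := hM'.exists_rep zero_lt_one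
  rw [hU.endData_eq zero_lt_one, hN.endData_eq zero_lt_one] at hbc
  have hu := Lp.memLp u
  have hM := Lp.memLp M
  have hf := Lp.memLp f
  have hMM : MemLp (fun x => M x - M' x) 2 (volume.restrict (Ioo (0 : ℝ) 1)) :=
    hM.sub hN.memLp_self
  have hkf : MemLp (fun x => k x + f x) 2 (volume.restrict (Ioo (0 : ℝ) 1)) := hN.memLp.add hf
  have hzero := fun j : Fin n =>
    H2Rep.zero_L2I (T.left j) (T.right j) (T.left_nonneg j) (T.right_le_one j)
  have z0 : ∀ (p : ℝ → ℝ) (j : Fin n),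
      ∫ x in Ioo (T.left j) (T.right j), p x * (0 : L2I) x = 0 := fun p j => by
    refine (integral_congr_ae (g := fun _ => (0 : ℝ)) ?_).trans (integral_zero _ _)
    filter_upwards [(hzero j).ae_eq] with x hx
    rw [hx, mul_zero]
  -- Taking `W = 0` isolates `(M - M')'' = -(M'' + f)`, where the right-hand `M''` is the second
  -- derivative `k` of `M'`.
  obtain ⟨P, P₁, hP, ⟨p1, p2, p3, p4⟩, hPT⟩ := T.rep_of_forall_sum_eq_zero hMM hkf
    fun z Z E k' hz => by
      have := hb z (mem_brokenH2_of_rep hz) 0 (mem_brokenH2_of_rep hzero)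
      rw [bilinForm_traceMap T t u M u' M' z 0 hU hN hz hzero,
        ← T.sum_integral (integrable_mul_of_memLp_two hf (Lp.memLp z)),
        ← sub_eq_zero, sub_neg_eq_add, add_assoc, ← Finset.sum_add_distrib] at this
      simp only [z0, mul_zero, integral_zero, add_zero, Finset.sum_const_zero, zero_add] at this
      refine Eq.trans ?_ this
      refine Finset.sum_congr rfl fun j _ => ?_
      rw [add_assoc, ← integral_add
        (integrable_mul_of_memLp_two (T.memLp_restrict hN.memLp j) (hz j).memLp_self)
        (integrable_mul_of_memLp_two (T.memLp_restrict hf j) (hz j).memLp_self)]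
      simp only [add_mul]
  have hpsi : MemLp (fun x => (u x - u' x) - t ^ 2 * (M x - M' x)) 2
      (volume.restrict (Ioo (0 : ℝ) 1)) := (hu.sub hU.memLp_self).sub (hMM.const_mul _)
  have hgg : MemLp (fun x => M x + g x - t ^ 2 * k x) 2
      (volume.restrict (Ioo (0 : ℝ) 1)) := (hM.add hU.memLp).sub (hN.memLp.const_mul _)
  -- Taking `z = 0` isolates the combination `(u - u') - t²(M - M')`; adding back `t²(M - M')` then
  -- recovers `u`.
  obtain ⟨R, R₁, hR, ⟨r1, r2, r3, r4⟩, hRT⟩ := T.rep_of_forall_sum_eq_zero hpsi hgg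
    fun W Y S m hW => by
      have := hb 0 (mem_brokenH2_of_rep hzero) W (mem_brokenH2_of_rep hW)
      rw [bilinForm_traceMap T t u M u' M' 0 W hU hN hzero hW,
        ← T.sum_integral (integrable_mul_of_memLp_two hf (Lp.memLp 0))] at this
      simpa only [z0, mul_zero, integral_zero, add_zero, Finset.sum_const_zero, neg_zero] using this
  have hMrep := (hN.add hP).congr (z := M) (ae_of_all _ fun x => by ring)
  have hurep := ((hU.add hR).add (hP.const_mul (t ^ 2))).congr (z := u)
    (ae_of_all _ fun x => by ring)
  refine ⟨_, _, _, _, ⟨hurep.congr_second zero_le_one (ae_of_all _ fun x => ?_),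
    hMrep.congr_second zero_le_one (ae_of_all _ fun x => ?_)⟩, ?_, ?_⟩
  · ring
  · ring
  · simpa only [p1, p2, p3, p4, r1, r2, r3, r4, mul_zero, add_zero] using hbc
  · rw [hU.traceMap_eq T, hN.traceMap_eq T, hurep.traceMap_eq T, hMrep.traceMap_eq T]
    simp only [hPT, hRT, mul_zero, add_zero]

namespace BeamRep

variable {t : ℝ} {f u M : L2I} {U U₁ N N₁ : ℝ → ℝ}

theorem mem_solutionSpace (h : BeamRep t f u M U U₁ N N₁) {a : BCType}
    (hbc : BoundaryCondition t ![U 0, U₁ 0, U 1, U₁ 1] ![N 0, N₁ 0, N 1, N₁ 1] a) :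
    (u, M) ∈ solutionSpace a t := by
  refine ⟨h.deflection.memH2 zero_le_one, h.moment.memH2 zero_le_one, ?_⟩
  simp only
  rwa [h.deflection.endData_eq zero_lt_one, h.moment.endData_eq zero_lt_one]

theorem solvesBeam (h : BeamRep t f u M U U₁ N N₁) : SolvesBeam t f u M := by
  have h1 := h.deflection.weakDeriv₂_ae_eq zero_le_one
  have h2 := h.moment.weakDeriv₂_ae_eq zero_le_one
  constructor
  · filter_upwards [h2] with x hx
    rw [hx, neg_neg]
  · filter_upwards [h1, h2] with x hx hx'
    rw [hx, hx']
    ring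

/-- With `(u, M)` as its own lift, all differences in `bilinForm_traceMap` vanish, the constitutive
residual is zero, and the load term remains. -/
theorem solvesVF (h : BeamRep t f u M U U₁ N N₁) {a : BCType}
    (hbc : BoundaryCondition t ![U 0, U₁ 0, U 1, U₁ 1] ![N 0, N₁ 0, N 1, N₁ 1] a)
    {n : ℕ} (T : Mesh n) : SolvesVF T a t f (u, M, (traceMap T u, traceMap T M)) := by
  refine ⟨⟨(u, M), h.mem_solutionSpace hbc, rfl⟩, fun z hz W hW => ?_⟩
  obtain ⟨Z, E, k, hZ⟩ := exists_rep_of_mem_brokenH2 hz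
  obtain ⟨Y, S, m, hY⟩ := exists_rep_of_mem_brokenH2 hW
  rw [bilinForm_traceMap T t u M u M z W h.deflection h.moment hZ hY,
    ← T.sum_integral (integrable_mul_of_memLp_two (Lp.memLp f) (Lp.memLp z)),
    ← Finset.sum_neg_distrib, ← Finset.sum_add_distrib]
  refine Finset.sum_congr rfl fun j _ => ?_
  have e : ∀ x, M x + (-(t ^ 2 * f x) - M x) - t ^ 2 * -f x = 0 := fun x => by ring
  simp only [e, sub_self, mul_zero, zero_mul, integral_zero, zero_add, neg_mul, integral_neg]

end BeamRep

/-! ### Representation of beam solutions by iterated primitives of the load -/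

theorem IsPrimitive.eqOn {a b : ℝ} {V D V' D' : ℝ → ℝ} (h : IsPrimitive a b V D)
    (h' : IsPrimitive a b V' D') (h0 : V a = V' a) (e : EqOn D D' (Icc a b)) :
    EqOn V V' (Icc a b) := by
  intro x hx
  rw [h.eq_add_integral x hx, h'.eq_add_integral x hx, h0]
  congr 1
  apply intervalIntegral.integral_congr
  intro s hs
  rw [uIcc_of_le hx.1] at hs
  exact e ⟨hs.1, hs.2.trans hx.2⟩

/-- The interval has length one, so repeated integration from `0` never worsens a bound. -/
theorem IsPrimitive.abs_le {V D : ℝ → ℝ} (h : IsPrimitive 0 1 V D) (h0 : V 0 = 0) {R : ℝ}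
    (hD : ∀ x ∈ Icc (0 : ℝ) 1, |D x| ≤ R) : ∀ x ∈ Icc (0 : ℝ) 1, |V x| ≤ R := by
  intro x hx
  have hR : 0 ≤ R := (abs_nonneg _).trans (hD x hx)
  rw [h.eq_add_integral x hx, h0, zero_add]
  have := intervalIntegral.norm_integral_le_of_norm_le_const (a := 0) (b := x) (f := D) (C := R)
    fun s hs => by
      rw [uIoc_of_le hx.1] at hs
      exact hD s ⟨hs.1.le, hs.2.trans hx.2⟩
  rw [Real.norm_eq_abs, sub_zero, abs_of_nonneg hx.1] at this
  exact this.trans (mul_le_of_le_one_right hR hx.2)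

/-- `F₁, …, F₄` are the iterated primitives of `f` vanishing at `0`. -/
structure IteratedPrimitives (f F₁ F₂ F₃ F₄ : ℝ → ℝ) : Prop where
  prim₁ : IsPrimitive 0 1 F₁ f
  prim₂ : IsPrimitive 0 1 F₂ F₁
  prim₃ : IsPrimitive 0 1 F₃ F₂
  prim₄ : IsPrimitive 0 1 F₄ F₃
  zero₁ : F₁ 0 = 0
  zero₂ : F₂ 0 = 0
  zero₃ : F₃ 0 = 0
  zero₄ : F₄ 0 = 0

theorem exists_iteratedPrimitives {f : ℝ → ℝ} (hf : IntervalIntegrable f volume 0 1) :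
    ∃ F₁ F₂ F₃ F₄, IteratedPrimitives f F₁ F₂ F₃ F₄ := by
  have step {D : ℝ → ℝ} (hD : IntervalIntegrable D volume 0 1) :
      ∃ V, IsPrimitive 0 1 V D ∧ V 0 = 0 :=
    ⟨_, isPrimitive_integral hD 0, by simp⟩
  have cont {V D : ℝ → ℝ} (h : IsPrimitive 0 1 V D) : IntervalIntegrable V volume 0 1 :=
    (h.continuousOn_uIcc zero_le_one).intervalIntegrable
  obtain ⟨F₁, h1, z1⟩ := step hf
  obtain ⟨F₂, h2, z2⟩ := step (cont h1)
  obtain ⟨F₃, h3, z3⟩ := step (cont h2)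
  obtain ⟨F₄, h4, z4⟩ := step (cont h3)
  exact ⟨F₁, F₂, F₃, F₄, h1, h2, h3, h4, z1, z2, z3, z4⟩

theorem isPrimitive_cubic (a b c d p q : ℝ) :
    IsPrimitive p q (fun x => a + b * x + c * x ^ 2 + d * x ^ 3)
      (fun x => b + 2 * c * x + 3 * d * x ^ 2) := by
  refine isPrimitive_of_hasDerivAt (fun x => ?_) (by fun_prop)
  have := (((hasDerivAt_id x).const_mul b).const_add a).add
    (((hasDerivAt_pow 2 x).const_mul c)) |>.add ((hasDerivAt_pow 3 x).const_mul d)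
  convert! this using 1
  simp
  ring

namespace IteratedPrimitives

variable {f F₁ F₂ F₃ F₄ : ℝ → ℝ}

theorem slope_moment (hF : IteratedPrimitives f F₁ F₂ F₃ F₄) (β : ℝ) :
    IsPrimitive 0 1 (fun x => β - F₁ x) (fun x => -f x) := by
  convert! (isPrimitive_cubic β 0 0 0 0 1).add (hF.prim₁.const_mul (-1)) using 2 <;> ring

theorem moment (hF : IteratedPrimitives f F₁ F₂ F₃ F₄) (α β : ℝ) :
    IsPrimitive 0 1 (fun x => α + β * x - F₂ x) (fun x => β - F₁ x) := by
  convert! (isPrimitive_cubic α β 0 0 0 1).add (hF.prim₂.const_mul (-1)) using 2 <;> ring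

theorem slope_potential (hF : IteratedPrimitives f F₁ F₂ F₃ F₄) (α β δ : ℝ) :
    IsPrimitive 0 1 (fun x => δ - α * x - β * x ^ 2 / 2 + F₃ x)
      (fun x => -(α + β * x - F₂ x)) := by
  convert! (isPrimitive_cubic δ (-α) (-β / 2) 0 0 1).add hF.prim₃ using 2 <;> ring

theorem potential (hF : IteratedPrimitives f F₁ F₂ F₃ F₄) (α β γ δ : ℝ) :
    IsPrimitive 0 1 (fun x => γ + δ * x - α * x ^ 2 / 2 - β * x ^ 3 / 6 + F₄ x)
      (fun x => δ - α * x - β * x ^ 2 / 2 + F₃ x) := by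
  convert! (isPrimitive_cubic γ δ (-α / 2) (-β / 6) 0 1).add hF.prim₄ using 2 <;> ring

end IteratedPrimitives

/-- Passing to `u - t²M` cancels the load from the second equation: its second derivative is `-M`.
The parameter `t` then enters only when `t²M` is added back. -/
theorem BeamRep.eqOn {t : ℝ} {f u M U U₁ N N₁ F₁ F₂ F₃ F₄ : ℝ → ℝ}
    (h : BeamRep t f u M U U₁ N N₁) (hF : IteratedPrimitives f F₁ F₂ F₃ F₄) :
    ∃ α β γ δ, ∀ x ∈ Icc (0 : ℝ) 1,
      N₁ x = β - F₁ x ∧ N x = α + β * x - F₂ x ∧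
      U₁ x = δ - α * x - β * x ^ 2 / 2 + F₃ x + t ^ 2 * N₁ x ∧
      U x = γ + δ * x - α * x ^ 2 / 2 - β * x ^ 3 / 6 + F₄ x + t ^ 2 * N x := by
  refine ⟨N 0, N₁ 0, U 0 - t ^ 2 * N 0, U₁ 0 - t ^ 2 * N₁ 0, ?_⟩
  have e1 := h.moment.slope.eqOn (hF.slope_moment (N₁ 0)) (by simp [hF.zero₁]) fun x _ => rfl
  have e2 := h.moment.value.eqOn (hF.moment (N 0) (N₁ 0)) (by simp [hF.zero₂]) e1
  have hs : IsPrimitive 0 1 (fun x => U₁ x + -t ^ 2 * N₁ x) (fun x => -N x) :=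
    (h.deflection.slope.add (h.moment.slope.const_mul (-t ^ 2))).congr_ae zero_le_one (by
      filter_upwards [h.moment.ae_eq] with x hx
      rw [hx]
      ring)
  have e3 := hs.eqOn (hF.slope_potential (N 0) (N₁ 0) (U₁ 0 - t ^ 2 * N₁ 0))
    (by simp [hF.zero₃]; ring) fun x hx => by simp only [e2 hx]
  have e4 := (h.deflection.value.add (h.moment.value.const_mul (-t ^ 2))).eqOn
    (hF.potential (N 0) (N₁ 0) (U 0 - t ^ 2 * N 0) (U₁ 0 - t ^ 2 * N₁ 0))
    (by simp [hF.zero₄]; ring) e3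
  intro x hx
  have h3 := e3 hx
  have h4 := e4 hx
  simp only at h3 h4
  exact ⟨e1 hx, e2 hx, by linarith, by linarith⟩

theorem IteratedPrimitives.abs_le {f F₁ F₂ F₃ F₄ : ℝ → ℝ}
    (hF : IteratedPrimitives f F₁ F₂ F₃ F₄) {R : ℝ} (hR : ∀ x ∈ Icc (0 : ℝ) 1, |F₁ x| ≤ R) :
    ∀ x ∈ Icc (0 : ℝ) 1, |F₁ x| ≤ R ∧ |F₂ x| ≤ R ∧ |F₃ x| ≤ R ∧ |F₄ x| ≤ R := by
  have h2 := hF.prim₂.abs_le hF.zero₂ hR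
  have h3 := hF.prim₃.abs_le hF.zero₃ h2
  have h4 := hF.prim₄.abs_le hF.zero₄ h3
  exact fun x hx => ⟨hR x hx, h2 x hx, h3 x hx, h4 x hx⟩

/-! ### The linear system for the boundary conditions -/

/-- Here `pᵢ` stands for `Fᵢ(1)`. Elimination leaves one equation with coefficient `t² + 1/12` for
`cc` and `t² + 1/3` for `cs`; for `cf` and `ss` the system is solved by substitution without any
division by a function of `t`. -/
theorem abs_le_of_boundaryCondition {a : BCType} {t : ℝ} (ht : t ∈ Icc (0 : ℝ) 1)
    {α β γ δ p₁ p₂ p₃ p₄ R : ℝ} (h1 : |p₁| ≤ R) (h2 : |p₂| ≤ R) (h3 : |p₃| ≤ R) (h4 : |p₄| ≤ R)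
    (h : BoundaryCondition t
      ![γ + t ^ 2 * α, δ + t ^ 2 * β, γ + δ - α / 2 - β / 6 + p₄ + t ^ 2 * (α + β - p₂),
        δ - α - β / 2 + p₃ + t ^ 2 * (β - p₁)] ![α, β, α + β - p₂, β - p₁] a) :
    |α| ≤ 30 * R ∧ |β| ≤ 30 * R ∧ |γ| ≤ 30 * R ∧ |δ| ≤ 30 * R := by
  have hR : 0 ≤ R := (abs_nonneg _).trans h1
  have hs : 0 ≤ t ^ 2 := sq_nonneg t
  have hs1 : t ^ 2 ≤ 1 := pow_le_one₀ ht.1 ht.2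
  rw [abs_le] at h1 h2 h3 h4
  have bd {c x y B : ℝ} (hc : 0 < c) (e : x * (t ^ 2 + c) = y) (hy : |y| ≤ c * B) : |x| ≤ B := by
    have : |x| * (t ^ 2 + c) ≤ c * B := by
      rw [← abs_of_pos (show 0 < t ^ 2 + c by linarith), ← abs_mul, e]
      exact hy
    nlinarith [abs_nonneg x, mul_nonneg (abs_nonneg x) hs]
  have sm {x y B : ℝ} (e : x = -(t ^ 2 * y)) (hy : |y| ≤ B) : |x| ≤ B := by
    rw [e, abs_neg, abs_mul, abs_of_nonneg hs]
    exact (mul_le_of_le_one_left (abs_nonneg y) hs1).trans hy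
  have sp : |t ^ 2 * p₂| ≤ R := by
    rw [abs_mul, abs_of_nonneg hs]
    exact (mul_le_of_le_one_left (abs_nonneg _) hs1).trans (abs_le.mpr h2)
  rw [abs_le] at sp
  cases a <;> simp only [BoundaryCondition, Matrix.cons_val] at h <;> obtain ⟨b1, b2, b3, b4⟩ := h
  · have hδ : δ = 0 := by linarith
    -- The right-hand side is at most `5R/2`, and `12 · 5/2 = 30`; this case determines the constant
    -- of the lemma.
    have hβ : |β| ≤ 30 * R := bd (c := 1 / 12) (y := t ^ 2 * p₂ + p₃ / 2 - p₄) (by norm_num)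
      (by linear_combination b3 - b1 - (1 / 2) * b4 - (1 / 2) * b2) (by
        rw [abs_le]; constructor <;> linarith)
    have hα : |α| ≤ 30 * R := by
      rw [abs_le] at hβ ⊢
      constructor <;> linarith
    exact ⟨hα, hβ, sm (by linarith) hα, by rw [hδ, abs_zero]; positivity⟩
  · have hδ : δ = 0 := by linarith
    have hα : |α| ≤ 12 * R := bd (c := 1 / 3) (y := p₄ - p₂ / 6) (by norm_num)
      (by linear_combination b1 + b2 - b3 + (t ^ 2 - 1 / 6) * b4) (by
        rw [abs_le]; constructor <;> linarith)
    have hα' : |α| ≤ 30 * R := by linarith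
    refine ⟨hα', ?_, sm (by linarith) hα', by rw [hδ, abs_zero]; positivity⟩
    rw [abs_le] at hα ⊢
    constructor <;> linarith
  · have hδ : δ = 0 := by linarith
    have hβ : β = p₁ := by linarith
    have hα : |α| ≤ 30 * R := by
      rw [abs_le]
      constructor <;> linarith
    exact ⟨hα, by rw [abs_le]; constructor <;> linarith, sm (by linarith) hα,
      by rw [hδ, abs_zero]; positivity⟩
  · subst b2
    have hγ : γ = 0 := by linarith
    have hδ : δ = β / 6 - p₄ := by linear_combination b3 - hγ - t ^ 2 * b4
    refine ⟨?_, ?_, ?_, ?_⟩ <;> rw [abs_le] <;> constructor <;> linarith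

theorem exists_boundaryCondition (a : BCType) (t p₁ p₂ p₃ p₄ : ℝ) :
    ∃ α β γ δ, BoundaryCondition t
      ![γ + t ^ 2 * α, δ + t ^ 2 * β, γ + δ - α / 2 - β / 6 + p₄ + t ^ 2 * (α + β - p₂),
        δ - α - β / 2 + p₃ + t ^ 2 * (β - p₁)] ![α, β, α + β - p₂, β - p₁] a := by
  have hs : 0 ≤ t ^ 2 := sq_nonneg t
  cases a <;> simp only [BoundaryCondition, Matrix.cons_val]
  · have hd : t ^ 2 + 1 / 12 ≠ 0 := by positivity
    set β := (t ^ 2 * p₂ + p₃ / 2 - p₄) / (t ^ 2 + 1 / 12) with hβ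
    have e : β * (t ^ 2 + 1 / 12) = t ^ 2 * p₂ + p₃ / 2 - p₄ := div_mul_cancel₀ _ hd
    refine ⟨p₃ - β / 2, β, -(t ^ 2 * (p₃ - β / 2)), 0, by ring, by ring, ?_, by ring⟩
    linear_combination e
  · have hd : t ^ 2 + 1 / 3 ≠ 0 := by positivity
    set α := (p₄ - p₂ / 6) / (t ^ 2 + 1 / 3) with hα
    have e : α * (t ^ 2 + 1 / 3) = p₄ - p₂ / 6 := div_mul_cancel₀ _ hd
    refine ⟨α, p₂ - α, -(t ^ 2 * α), 0, by ring, by ring, ?_, by ring⟩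
    linear_combination -e
  · exact ⟨p₂ - p₁, p₁, -(t ^ 2 * (p₂ - p₁)), 0, by ring, by ring, by ring, by ring⟩
  · exact ⟨0, p₂, 0, p₂ / 6 - p₄, by ring, by ring, by ring, by ring⟩

/-! ### Well-posedness of the boundary value problem -/

/-- The cubic and the iterated primitives are bounded term by term. The load enters only through a
bound on its primitive, so `R = 0` is admissible for zero load, which is how uniqueness follows. -/
theorem BeamRep.abs_le {t : ℝ} (ht : t ∈ Icc (0 : ℝ) 1) {f u M U U₁ N N₁ : ℝ → ℝ}
    (h : BeamRep t f u M U U₁ N N₁) {a : BCType}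
    (hbc : BoundaryCondition t ![U 0, U₁ 0, U 1, U₁ 1] ![N 0, N₁ 0, N 1, N₁ 1] a)
    {R : ℝ} (hR : ∀ x ∈ Icc (0 : ℝ) 1, |∫ s in 0..x, f s| ≤ R) :
    ∀ x ∈ Icc (0 : ℝ) 1, |U x| ≤ 150 * R ∧ |U₁ x| ≤ 150 * R ∧ |N x| ≤ 150 * R ∧
      |N₁ x| ≤ 150 * R := by
  have hf : IntervalIntegrable f volume 0 1 := by
    simpa using h.moment.slope.intervalIntegrable.const_mul (-1)
  obtain ⟨F₁, F₂, F₃, F₄, hF⟩ := exists_iteratedPrimitives hf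
  have hb := hF.abs_le (R := R) fun x hx => by
    rw [hF.prim₁.eq_add_integral x hx, hF.zero₁, zero_add]
    exact hR x hx
  obtain ⟨α, β, γ, δ, e⟩ := h.eqOn hF
  obtain ⟨a1, a2, a3, a4⟩ := e 0 (by simp)
  obtain ⟨c1, c2, c3, c4⟩ := e 1 (by simp)
  obtain ⟨q1, q2, q3, q4⟩ := hb 1 (by simp)
  have z1 : N₁ 0 = β := by rw [a1, hF.zero₁]; ring
  have z2 : N 0 = α := by rw [a2, hF.zero₂]; ring
  have z3 : U₁ 0 = δ + t ^ 2 * β := by rw [a3, hF.zero₃, z1]; ring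
  have z4 : U 0 = γ + t ^ 2 * α := by rw [a4, hF.zero₄, z2]; ring
  have y2 : N 1 = α + β - F₂ 1 := by rw [c2]; ring
  have y3 : U₁ 1 = δ - α - β / 2 + F₃ 1 + t ^ 2 * (β - F₁ 1) := by rw [c3, c1]; ring
  have y4 : U 1 = γ + δ - α / 2 - β / 6 + F₄ 1 + t ^ 2 * (α + β - F₂ 1) := by rw [c4, y2]; ring
  rw [z1, z2, z3, z4, c1, y2, y3, y4] at hbc
  obtain ⟨k1, k2, k3, k4⟩ := abs_le_of_boundaryCondition ht q1 q2 q3 q4 hbc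
  intro x hx
  obtain ⟨b1, b2, b3, b4⟩ := hb x hx
  obtain ⟨d1, d2, d3, d4⟩ := e x hx
  have hR0 : 0 ≤ R := (abs_nonneg _).trans b1
  have hs : 0 ≤ t ^ 2 := sq_nonneg t
  have hs1 : t ^ 2 ≤ 1 := pow_le_one₀ ht.1 ht.2
  have mono {c y : ℝ} (hc0 : 0 ≤ c) (hc1 : c ≤ 1) {B : ℝ} (hy : |y| ≤ B) : |y * c| ≤ B := by
    rw [abs_mul, abs_of_nonneg hc0]
    exact (mul_le_of_le_one_right (abs_nonneg y) hc1).trans hy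
  have x2 := pow_le_one₀ (n := 2) hx.1 hx.2
  have x3 := pow_le_one₀ (n := 3) hx.1 hx.2
  have m1 := mono hx.1 hx.2 k2
  have m2 := mono hx.1 hx.2 k4
  have m3 := mono hx.1 hx.2 k1
  have m4 := mono (pow_nonneg hx.1 2) x2 k1
  have m5 := mono (pow_nonneg hx.1 2) x2 k2
  have m6 := mono (pow_nonneg hx.1 3) x3 k2
  have n1 : |N₁ x| ≤ 31 * R := by
    rw [d1]
    exact (abs_sub _ _).trans (by linarith)
  have n2 : |N x| ≤ 61 * R := by
    rw [d2, _root_.abs_le]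
    rw [_root_.abs_le] at *
    constructor <;> linarith
  have n1' := mono hs hs1 n1
  have n2' := mono hs hs1 n2
  have n3 : |U₁ x| ≤ 150 * R := by
    rw [d3, _root_.abs_le]
    rw [_root_.abs_le] at *
    constructor <;> linarith
  have n4 : |U x| ≤ 150 * R := by
    rw [d4, _root_.abs_le]
    rw [_root_.abs_le] at *
    constructor <;> linarith
  exact ⟨n4, n3, by linarith, by linarith⟩

theorem BoundaryCondition.sub {t : ℝ} {u M u' M' u'' M'' : Fin 4 → ℝ} {a : BCType}
    (h : BoundaryCondition t u M a) (h' : BoundaryCondition t u' M' a)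
    (eu : ∀ i, u'' i = u i + -1 * u' i) (eM : ∀ i, M'' i = M i + -1 * M' i) :
    BoundaryCondition t u'' M'' a := by
  cases a <;> simp only [BoundaryCondition, eu, eM] at * <;> obtain ⟨h1, h2, h3, h4⟩ := h <;>
    obtain ⟨k1, k2, k3, k4⟩ := h' <;> refine ⟨?_, ?_, ?_, ?_⟩ <;> linarith

theorem BeamRep.unique {t : ℝ} (ht : t ∈ Icc (0 : ℝ) 1) {f u M u' M' : L2I}
    {U U₁ N N₁ U' U₁' N' N₁' : ℝ → ℝ}
    (h : BeamRep t f u M U U₁ N N₁) (h' : BeamRep t f u' M' U' U₁' N' N₁') {a : BCType}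
    (hbc : BoundaryCondition t ![U 0, U₁ 0, U 1, U₁ 1] ![N 0, N₁ 0, N 1, N₁ 1] a)
    (hbc' : BoundaryCondition t ![U' 0, U₁' 0, U' 1, U₁' 1] ![N' 0, N₁' 0, N' 1, N₁' 1] a) :
    u = u' ∧ M = M' := by
  -- The difference of two solutions is a beam with zero load, to which the a priori bound applies.
  have hd : BeamRep t (fun _ => 0) _ _ _ _ _ _ :=
    ⟨(h.deflection.add (h'.deflection.const_mul (-1))).congr_second zero_le_one
        (ae_of_all _ fun x => by ring),
      (h.moment.add (h'.moment.const_mul (-1))).congr_second zero_le_one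
        (ae_of_all _ fun x => by ring)⟩
  have hb := hd.abs_le ht (hbc.sub hbc' (fun i => by fin_cases i <;> rfl)
    (fun i => by fin_cases i <;> rfl)) (R := 0) (fun x _ => by simp)
  simp only [mul_zero, abs_nonpos_iff] at hb
  constructor
  · apply Lp.ext
    filter_upwards [h.deflection.ae_eq, h'.deflection.ae_eq, ae_restrict_mem measurableSet_Ioo]
      with x hx hx' hm
    linarith [(hb x (Ioo_subset_Icc_self hm)).1]
  · apply Lp.ext
    filter_upwards [h.moment.ae_eq, h'.moment.ae_eq, ae_restrict_mem measurableSet_Ioo]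
      with x hx hx' hm
    linarith [(hb x (Ioo_subset_Icc_self hm)).2.2.1]

theorem exists_beamRep (a : BCType) (t : ℝ) (f : L2I) :
    ∃ (u M : L2I) (U U₁ N N₁ : ℝ → ℝ), BeamRep t f u M U U₁ N N₁ ∧
      BoundaryCondition t ![U 0, U₁ 0, U 1, U₁ 1] ![N 0, N₁ 0, N 1, N₁ 1] a := by
  obtain ⟨F₁, F₂, F₃, F₄, hF⟩ := exists_iteratedPrimitives
    (intervalIntegrable_of_memLp_two zero_le_one (Lp.memLp f))
  obtain ⟨α, β, γ, δ, hbc⟩ := exists_boundaryCondition a t (F₁ 1) (F₂ 1) (F₃ 1) (F₄ 1)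
  have hN := hF.moment α β
  have hN₁ := hF.slope_moment β
  have hU := (hF.potential α β γ δ).add (hN.const_mul (t ^ 2))
  have hU₁ := (hF.slope_potential α β δ).add (hN₁.const_mul (t ^ 2))
  have hNm := memLp_of_continuousOn hN.continuousOn 2
  have hUm := memLp_of_continuousOn hU.continuousOn 2
  have eN := hNm.coeFn_toLp
  have hu := H2Rep.congr_second (g' := fun x => -(t ^ 2 * f x) - (hNm.toLp _ : L2I) x)
    ⟨hUm.coeFn_toLp, hU, hU₁, hNm.neg.add ((Lp.memLp f).neg.const_mul (t ^ 2))⟩ zero_le_one (by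
      filter_upwards [eN] with x hx
      rw [hx]
      ring)
  have hrep : BeamRep t f (hUm.toLp _) (hNm.toLp _) _ _ _ _ :=
    ⟨hu, ⟨eN, hN, hN₁, (Lp.memLp f).neg⟩⟩
  refine ⟨_, _, _, _, _, _, hrep, ?_⟩
  convert! hbc using 1
  · ext i
    fin_cases i <;> simp [hF.zero₁, hF.zero₂, hF.zero₃, hF.zero₄]
  · ext i
    fin_cases i <;> simp [hF.zero₁, hF.zero₂]

/-! ### Estimates for the trace norm -/

theorem sq_integral_abs_le {a b : ℝ} (hab : a < b) {g : ℝ → ℝ}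
    (hg : MemLp g 2 (volume.restrict (Ioo a b))) :
    (∫ x in a..b, |g x|) ^ 2 ≤ (b - a) * ∫ x in Ioo a b, g x ^ 2 := by
  have hba : 0 < b - a := sub_pos.mpr hab
  set s := ∫ x in a..b, |g x| with hs
  set c := s / (b - a) with hc
  have i1 : IntervalIntegrable (fun x => |g x|) volume a b :=
    (intervalIntegrable_of_memLp_two hab.le hg).abs
  have i2 : IntervalIntegrable (fun x => g x ^ 2) volume a b :=
    (intervalIntegrable_iff_Ioo hab.le _).mpr hg.integrable_sq
  -- Cauchy–Schwarz from the variance of `|g|`: the integrand is `(|g| - c)²`, with `c` the mean of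
  -- `|g|`.
  have h0 : 0 ≤ ∫ x in a..b, ((g x ^ 2 - 2 * c * |g x|) + c ^ 2) := by
    apply intervalIntegral.integral_nonneg hab.le
    intro x _
    nlinarith [sq_nonneg (|g x| - c), sq_abs (g x)]
  rw [intervalIntegral.integral_add (i2.sub (i1.const_mul _)) intervalIntegrable_const,
    intervalIntegral.integral_sub i2 (i1.const_mul _), intervalIntegral.integral_const_mul, ← hs,
    intervalIntegral.integral_const, smul_eq_mul] at h0
  rw [setIntegral_Ioo_eq hab.le]
  have hcs : c * (b - a) = s := div_mul_cancel₀ _ hba.ne'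
  nlinarith [mul_nonneg hba.le h0]

/-- The first part is the mass form of the cubic Hermite interpolant, the second its bending energy.
The latter depends only on the deviations of the end slopes from the chord slope, which turns the
factor `h⁻³` into `h⁻¹`. -/
theorem localTraceNormSq_eq {h : ℝ} (hh : h ≠ 0) (d : Fin 4 → ℝ) :
    localTraceNormSq h d =
      h / 420 * (156 * (d 0 ^ 2 + d 2 ^ 2) + 4 * h ^ 2 * (d 1 ^ 2 + d 3 ^ 2)
        + 108 * d 0 * d 2 + 44 * h * (d 0 * d 1 - d 2 * d 3)
        - 6 * h ^ 2 * d 1 * d 3 + 26 * h * (d 2 * d 1 - d 0 * d 3))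
      + 4 / h * ((d 1 - (d 2 - d 0) / h) ^ 2
        + (d 1 - (d 2 - d 0) / h) * (d 3 - (d 2 - d 0) / h) + (d 3 - (d 2 - d 0) / h) ^ 2) := by
  rw [localTraceNormSq]
  field_simp
  ring

theorem massForm_le {h B d₀ d₁ d₂ d₃ : ℝ} (h0 : 0 ≤ h) (h1 : h ≤ 1) (b0 : |d₀| ≤ B)
    (b1 : |d₁| ≤ B) (b2 : |d₂| ≤ B) (b3 : |d₃| ≤ B) :
    h / 420 * (156 * (d₀ ^ 2 + d₂ ^ 2) + 4 * h ^ 2 * (d₁ ^ 2 + d₃ ^ 2)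
        + 108 * d₀ * d₂ + 44 * h * (d₀ * d₁ - d₂ * d₃)
        - 6 * h ^ 2 * d₁ * d₃ + 26 * h * (d₂ * d₁ - d₀ * d₃)) ≤ 2 * h * B ^ 2 := by
  have hB : 0 ≤ B := (abs_nonneg _).trans b0
  have c1 : |h * d₁| ≤ B := by
    rw [abs_mul, abs_of_nonneg h0]
    exact (mul_le_of_le_one_left (abs_nonneg _) h1).trans b1
  have c3 : |h * d₃| ≤ B := by
    rw [abs_mul, abs_of_nonneg h0]
    exact (mul_le_of_le_one_left (abs_nonneg _) h1).trans b3
  have pr {x y : ℝ} (hx : |x| ≤ B) (hy : |y| ≤ B) : |x * y| ≤ B ^ 2 := by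
    rw [abs_mul, sq]
    exact mul_le_mul hx hy (abs_nonneg _) hB
  have p00 := abs_le.mp (pr b0 b0)
  have p22 := abs_le.mp (pr b2 b2)
  have p11 := abs_le.mp (pr c1 c1)
  have p33 := abs_le.mp (pr c3 c3)
  have p02 := abs_le.mp (pr b0 b2)
  have p01 := abs_le.mp (pr b0 c1)
  have p23 := abs_le.mp (pr b2 c3)
  have p13 := abs_le.mp (pr c1 c3)
  have p21 := abs_le.mp (pr b2 c1)
  have p03 := abs_le.mp (pr b0 c3)
  -- The absolute values of the coefficients add up to `574`; `840` is a round multiple of `420`.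
  have : 156 * (d₀ ^ 2 + d₂ ^ 2) + 4 * h ^ 2 * (d₁ ^ 2 + d₃ ^ 2)
        + 108 * d₀ * d₂ + 44 * h * (d₀ * d₁ - d₂ * d₃)
        - 6 * h ^ 2 * d₁ * d₃ + 26 * h * (d₂ * d₁ - d₀ * d₃) ≤ 840 * B ^ 2 := by
    nlinarith
  calc _ ≤ h / 420 * (840 * B ^ 2) := mul_le_mul_of_nonneg_left this (by positivity)
    _ = _ := by ring

/-- The chord slope is the mean of `D`, so each end slope deviates from it by at most `∫ |g|`. By
Cauchy–Schwarz the square of this is at most the length times `∫ g²`, and the length cancels the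
factor `h⁻¹` of the bending part. -/
theorem H2Rep.localTraceNormSq_le {l r B : ℝ} (hlr : l < r) (hh : r - l ≤ 1)
    {v V D g : ℝ → ℝ} (h : H2Rep l r v V D g)
    (hV : ∀ x ∈ Icc l r, |V x| ≤ B) (hD : ∀ x ∈ Icc l r, |D x| ≤ B) :
    localTraceNormSq (r - l) ![V l, D l, V r, D r] ≤
      2 * (r - l) * B ^ 2 + 12 * ∫ x in Ioo l r, g x ^ 2 := by
  have hpos : 0 < r - l := sub_pos.mpr hlr
  have hl : l ∈ Icc l r := ⟨le_rfl, hlr.le⟩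
  have hr : r ∈ Icc l r := ⟨hlr.le, le_rfl⟩
  set s := ∫ x in l..r, |g x| with hs
  have cs : s ^ 2 ≤ _ := sq_integral_abs_le hlr h.memLp
  have hs0 : 0 ≤ s := intervalIntegral.integral_nonneg hlr.le fun x _ => abs_nonneg _
  have osc : ∀ x ∈ Icc l r, ∀ y ∈ Icc l r, |D x - D y| ≤ s := by
    intro x hx y hy
    rw [h.slope.sub_eq_integral hy hx, ← Real.norm_eq_abs]
    refine intervalIntegral.norm_integral_le_abs_integral_norm.trans ?_
    rw [← abs_of_nonneg hs0]
    apply intervalIntegral.abs_integral_mono_interval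
    · rw [uIoc_of_le hlr.le]
      intro z hz
      rw [mem_uIoc] at hz
      rcases hz with hz | hz
      · exact ⟨hy.1.trans_lt hz.1, hz.2.trans hx.2⟩
      · exact ⟨hx.1.trans_lt hz.1, hz.2.trans hy.2⟩
    · exact ae_of_all _ fun x => abs_nonneg _
    · exact h.slope.intervalIntegrable.abs
  have dev : ∀ y ∈ Icc l r, |D y - (V r - V l) / (r - l)| ≤ s := by
    intro y hy
    have e : D y - (V r - V l) / (r - l) = (∫ x in l..r, (D y - D x)) / (r - l) := by
      rw [h.value.sub_eq_integral hl hr, intervalIntegral.integral_sub intervalIntegrable_const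
        h.value.intervalIntegrable, intervalIntegral.integral_const, smul_eq_mul]
      field_simp
    rw [e, abs_div, abs_of_pos hpos, div_le_iff₀ hpos]
    have := intervalIntegral.norm_integral_le_of_norm_le_const (a := l) (b := r)
      (f := fun x => D y - D x) (C := s) fun x hx => by
        rw [uIoc_of_le hlr.le] at hx
        exact osc y hy x (Ioc_subset_Icc_self hx)
    rwa [abs_of_pos hpos] at this
  rw [localTraceNormSq_eq hpos.ne']
  simp only [Matrix.cons_val]
  have d1 := dev l hl
  have d3 := dev r hr
  generalize D l - (V r - V l) / (r - l) = p at *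
  generalize D r - (V r - V l) / (r - l) = q at *
  refine add_le_add (massForm_le hpos.le hh (hV l hl) (hD l hl) (hV r hr) (hD r hr)) ?_
  have hpq : p ^ 2 + p * q + q ^ 2 ≤ 3 * s ^ 2 := by
    have hp := sq_le_sq' (abs_le.mp d1).1 (abs_le.mp d1).2
    have hq := sq_le_sq' (abs_le.mp d3).1 (abs_le.mp d3).2
    nlinarith [sq_nonneg (p - q)]
  calc 4 / (r - l) * (p ^ 2 + p * q + q ^ 2)
      ≤ 4 / (r - l) * (3 * ((r - l) * ∫ x in Ioo l r, g x ^ 2)) :=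
        mul_le_mul_of_nonneg_left (by linarith) (by positivity)
    _ = _ := by field_simp; ring

/-! ### Stability -/

theorem norm_sq_eq_integral (f : L2I) : ‖f‖ ^ 2 = ∫ x in Ioo (0 : ℝ) 1, f x ^ 2 := by
  rw [← real_inner_self_eq_norm_sq, L2.inner_def]
  congr 1
  ext x
  simp [sq]

theorem abs_integral_le_norm (f : L2I) {x : ℝ} (hx : x ∈ Icc (0 : ℝ) 1) :
    |∫ s in 0..x, f s| ≤ ‖f‖ := by
  have hi := intervalIntegrable_of_memLp_two zero_le_one (Lp.memLp f)
  have h1 : |∫ s in 0..x, f s| ≤ ∫ s in 0..x, |f s| :=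
    intervalIntegral.abs_integral_le_integral_abs hx.1
  have h2 : ∫ s in 0..x, |f s| ≤ ∫ s in (0 : ℝ)..1, |f s| :=
    intervalIntegral.integral_mono_interval le_rfl hx.1 hx.2
      (ae_of_all _ fun s => abs_nonneg _) hi.abs
  have h3 := sq_integral_abs_le zero_lt_one (Lp.memLp f)
  rw [← norm_sq_eq_integral, sub_zero, one_mul] at h3
  exact h1.trans (h2.trans (abs_le_of_sq_le_sq' h3 (norm_nonneg _)).2)

theorem H2Rep.norm_sq_le {v : L2I} {V D g : ℝ → ℝ} (h : H2Rep 0 1 v V D g) {B : ℝ}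
    (hV : ∀ x ∈ Icc (0 : ℝ) 1, |V x| ≤ B) : ‖v‖ ^ 2 ≤ B ^ 2 := by
  rw [norm_sq_eq_integral]
  have hc : ∫ _ in Ioo (0 : ℝ) 1, B ^ 2 = B ^ 2 := by simp
  rw [← hc]
  apply integral_mono_ae (Lp.memLp v).integrable_sq (integrable_const _)
  filter_upwards [h.ae_eq, ae_restrict_mem measurableSet_Ioo] with x hx hm
  rw [hx]
  exact sq_le_sq' (abs_le.mp (hV x (Ioo_subset_Icc_self hm))).1
    (abs_le.mp (hV x (Ioo_subset_Icc_self hm))).2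

theorem Mesh.sum_length {n : ℕ} (T : Mesh n) : ∑ j, (T.right j - T.left j) = 1 := by
  have := T.sum_integral (F := fun _ => 1) (by simp)
  simpa [(T.left_lt_right _).le] using this

/-- The pointwise bounds are weighted by element lengths, which sum to one, and the integrals add
up; no mesh quantity survives. -/
theorem H2Rep.sum_localTraceNormSq_le {n : ℕ} (T : Mesh n) {v : L2I} {V D g : ℝ → ℝ}
    (h : H2Rep 0 1 v V D g) {B : ℝ}
    (hV : ∀ x ∈ Icc (0 : ℝ) 1, |V x| ≤ B) (hD : ∀ x ∈ Icc (0 : ℝ) 1, |D x| ≤ B) :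
    ∑ j, localTraceNormSq (T.right j - T.left j) (traceMap T v j) ≤
      2 * B ^ 2 + 12 * ∫ x in Ioo (0 : ℝ) 1, g x ^ 2 := by
  have hle : ∀ j, localTraceNormSq (T.right j - T.left j) (traceMap T v j) ≤
      2 * (T.right j - T.left j) * B ^ 2 + 12 * ∫ x in Ioo (T.left j) (T.right j), g x ^ 2 := by
    intro j
    have hsub : Icc (T.left j) (T.right j) ⊆ Icc 0 1 :=
      Icc_subset_Icc (T.left_nonneg j) (T.right_le_one j)
    rw [h.traceMap_eq T]
    exact (h.restrict T j).localTraceNormSq_le (T.left_lt_right j)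
      (by linarith [T.left_nonneg j, T.right_le_one j])
      (fun x hx => hV x (hsub hx)) (fun x hx => hD x (hsub hx))
  refine (Finset.sum_le_sum fun j _ => hle j).trans_eq ?_
  rw [Finset.sum_add_distrib, ← Finset.mul_sum, T.sum_integral h.memLp.integrable_sq,
    ← Finset.sum_mul, ← Finset.mul_sum, T.sum_length, mul_one]

theorem BeamRep.trialNorm_le {t : ℝ} (ht : t ∈ Icc (0 : ℝ) 1) {f u M : L2I}
    {U U₁ N N₁ : ℝ → ℝ} (h : BeamRep t f u M U U₁ N N₁) {a : BCType}
    (hbc : BoundaryCondition t ![U 0, U₁ 0, U 1, U₁ 1] ![N 0, N₁ 0, N 1, N₁ 1] a)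
    {n : ℕ} (T : Mesh n) : trialNorm T (u, M, (traceMap T u, traceMap T M)) ≤ 1000 * ‖f‖ := by
  have hb := h.abs_le ht hbc fun x hx => abs_integral_le_norm f hx
  have bu := h.deflection.norm_sq_le fun x hx => (hb x hx).1
  have bM := h.moment.norm_sq_le fun x hx => (hb x hx).2.2.1
  have tu := h.deflection.sum_localTraceNormSq_le T (fun x hx => (hb x hx).1)
    (fun x hx => (hb x hx).2.1)
  have tM := h.moment.sum_localTraceNormSq_le T (fun x hx => (hb x hx).2.2.1)
    (fun x hx => (hb x hx).2.2.2)
  simp only [neg_sq] at tM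
  rw [← norm_sq_eq_integral] at tM
  have hu2 : ∫ x in Ioo (0 : ℝ) 1, (-(t ^ 2 * f x) - M x) ^ 2 ≤ 2 * ‖f‖ ^ 2 + 2 * ‖M‖ ^ 2 := by
    rw [norm_sq_eq_integral, norm_sq_eq_integral, ← integral_const_mul, ← integral_const_mul,
      ← integral_add ((Lp.memLp f).integrable_sq.const_mul 2)
        ((Lp.memLp M).integrable_sq.const_mul 2)]
    apply integral_mono h.deflection.memLp.integrable_sq
      (((Lp.memLp f).integrable_sq.const_mul 2).add ((Lp.memLp M).integrable_sq.const_mul 2))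
    intro x
    have h4 : (t ^ 2) ^ 2 ≤ 1 := pow_le_one₀ (sq_nonneg t) (pow_le_one₀ ht.1 ht.2)
    simp only [Pi.add_apply]
    nlinarith [sq_nonneg (t ^ 2 * f x - M x), mul_le_mul_of_nonneg_right h4 (sq_nonneg (f x))]
  rw [trialNorm]
  apply Real.sqrt_le_iff.mpr ⟨by positivity, ?_⟩
  simp only [traceNormSq, Finset.sum_add_distrib]
  -- With `B = 150‖f‖` the collected terms are at most `30B² + 36‖f‖²`, which is below `1000²‖f‖²`.
  nlinarith [sq_nonneg ‖f‖]

end Timoshenko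

theorem theorem1 :
    ∃ C : ℝ, 0 < C ∧
      ∀ (a : Timoshenko.BCType) (t : ℝ), t ∈ Set.Icc (0 : ℝ) 1 →
      ∀ (n : ℕ) (T : Timoshenko.Mesh n) (f : Timoshenko.L2I),
        (∃! s : Timoshenko.L2I × Timoshenko.L2I × Timoshenko.TraceData n,
          Timoshenko.SolvesVF T a t f s) ∧
        ∀ (u M : Timoshenko.L2I) (q : Timoshenko.TraceData n),
          Timoshenko.SolvesVF T a t f (u, M, q) →
            Timoshenko.trialNorm T (u, M, q) ≤ C * ‖f‖ ∧
            (u, M) ∈ Timoshenko.solutionSpace a t ∧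
            Timoshenko.SolvesBeam t f u M ∧
            q = (Timoshenko.traceMap T u, Timoshenko.traceMap T M) := by
  refine ⟨1000, by norm_num, fun a t ht n T f => ⟨?_, fun u M q h => ?_⟩⟩
  · obtain ⟨u, M, U, U₁, N, N₁, h, hbc⟩ := Timoshenko.exists_beamRep a t f
    refine ⟨_, h.solvesVF hbc T, ?_⟩
    rintro ⟨u', M', q'⟩ h'
    -- The trace component is forced to be the trace of `(u', M')`, so uniqueness only concerns the
    -- pair.
    obtain ⟨_, _, _, _, hr, hbc', rfl⟩ := h'.exists_beamRep
    obtain ⟨rfl, rfl⟩ := hr.unique ht h hbc' hbc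
    rfl
  · obtain ⟨_, _, _, _, hr, hbc, rfl⟩ := h.exists_beamRep
    exact ⟨hr.trialNorm_le ht hbc T, hr.mem_solutionSpace hbc, hr.solvesBeam, rfl⟩
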